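/- **Proposition (1-bit estimation has distortion $O(1/N)$).** Fix $\lambda>1$, put $a=(\lambda-1)/2$, and let $$\phi(t)=\frac{\sin((\pi+a)t)\,\sin(at)}{\pi a t^2}\ (t\neq 0),\qquad \phi(0)=1+\frac a\pi .$$ Put $C_\phi=\int_{\mathbb R}|\phi|$, $K_\phi=\int_{\mathbb R}|\phi'|$ and $C_\phi''=\sup_{t\in\mathbb R}\sum_{k\in\mathbb Z}|\phi(t-k/\lambda)|^2$. Let $g:\mathbb R\to\mathbb R$ satisfy $|g(t)|\le 1$ and $(g\star\phi)(t)=g(t)$ for all $t$. On a probability space let $W(t)\sim\mathcal N(0,\sigma_W^2)$ (noise) and $W_d(t)\sim\mathcal N(0,\sigma_d^2)$ (dither), $t\in\mathbb R$, be mutually independent random variables, with $\sigma^2=\sigma_W^2+\sigma_d^2>0$. Let $F$ and $f$ be the distribution function and the density of $\mathcal N(0,\sigma^2)$, let $\delta=f(C_\phi)$ and $\Delta=f(0)$, and let $\mu>0$ satisfy the variance condition $$\Bigl(1-\frac1{\sqrt2\,C_\phi^2}\Bigr)\frac1\delta<\mu<\frac1\Delta .$$ For an integer $N\ge1$ let $\tau=1/(\lambda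 N)$, $X(s)=\mathbf 1\bigl(g(s)+W(s)+W_d(s)\ge 0\bigr)$ and $$H_N(t)=\tau\sum_{n\in\mathbb Z}\bigl(X(n\tau)-\tfrac12\bigr)\phi(t-n\tau).$$ Let $\mathrm{Clip}[x]=x$ if $|x|\le 1$ and $\mathrm{Clip}[x]=\mathrm{sgn}(x)$ otherwise. Let $G_0=0$ and $$G_{k+1}=\mathrm{Clip}\bigl[\mu H_N+\bigl(G_k-\mu(F(G_k)-\tfrac12)\bigr)\star\phi\bigr]\star\phi ,\qquad k\ge 0 .$$ Then for every $N\ge1$ and every outcome the sequence $G_k$ converges uniformly on $\mathbb R$; its limit $\widehat G_{\text{1-bit}}$ has a finite mean-squared error, bounded uniformly in $t$. With $\beta=2C_\phi^4|1-\mu\delta|^2$ one has $\beta<1$ and $$\sup_{t\in\mathbb R}\mathbb E\bigl(\widehat G_{\text{1-bit}}(t)-g(t)\bigr)^2\le\frac{2C_\phi^2\mu^2}{1-\beta}\left(\frac{C_2}{N}+\frac{C_3^2}{N^2}\right),\qquad C_2=\frac{C_\phi''}{4\lambda^2},\quad C_3=\frac{\bigl(\Delta\,C_\phi+F(1)-\tfrac12\bigr)K_\phi}{\lambda}.$$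 In particular $\sup_{t}\mathbb E(\widehat G_{\text{1-bit}}(t)-g(t))^2=O(1/N)$ as $N\to\infty$, with a constant that depends only on $\lambda,\sigma,\mu$ and not on $g$. -/

import Mathlib

open MeasureTheory ProbabilityTheory Filter Topology Asymptotics
open scoped NNReal Convolution

noncomputable section

namespace OneBit

/-- The stable interpolation kernel `φ` with stability constant `lam > 1`. -/
def phi (lam : ℝ) (t : ℝ) : ℝ :=
  if t = 0 then 1 + ((lam - 1) / 2) / Real.pi
  else 1 / (Real.pi * ((lam - 1) / 2) * t ^ 2) *
    (Real.sin ((Real.pi + (lam - 1) / 2) * t) * Real.sin (((lam - 1) / 2) * t))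

/-- Convolution of real signals, `(m ⋆ k) t = ∫ u, m u * k (t - u)`. -/
def conv (m k : ℝ → ℝ) : ℝ → ℝ :=
  m ⋆[ContinuousLinearMap.mul ℝ ℝ, volume] k

/-- The signal class: signals with `|g| ≤ 1` and `g ⋆ φ = g` everywhere. Such a `g` is automatically
measurable: otherwise the integrals defining `g ⋆ φ = g` would vanish, forcing `g = 0`. -/
def BLint (lam : ℝ) : Set (ℝ → ℝ) :=
  {g | ∀ t, |g t| ≤ 1 ∧ conv g (phi lam) t = g t}

/-- `C_φ = ∫ |φ|`. -/
def Cphi (lam : ℝ) : ℝ := ∫ t, |phi lam t|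

/-- `K_φ = ∫ |φ'|`. -/
def Kphi (lam : ℝ) : ℝ := ∫ t, |deriv (phi lam) t|

/-- `C_φ'' = sup_t ∑_k |φ (t - k / lam)|²`. -/
def Cphi2 (lam : ℝ) : ℝ := ⨆ t : ℝ, ∑' k : ℤ, |phi lam (t - (k : ℝ) / lam)| ^ 2

/-- The distribution function of the total noise, a centred Gaussian of variance `v`. -/
def F (v : ℝ≥0) (x : ℝ) : ℝ := cdf (gaussianReal 0 v) x

/-- The density of the total noise. -/
def f (v : ℝ≥0) (x : ℝ) : ℝ := gaussianPDFReal 0 v x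

/-- The variance condition on `μ`, where `δ = f (C_φ)` and `Δ = f 0`. -/
def VarianceCondition (lam : ℝ) (v : ℝ≥0) (μ : ℝ) : Prop :=
  (1 - 1 / (Real.sqrt 2 * Cphi lam ^ 2)) * (1 / f v (Cphi lam)) < μ ∧ μ < 1 / f v 0

/-- Clip to one. -/
def clip (x : ℝ) : ℝ := if |x| ≤ 1 then x else Real.sign x

/-- The one-bit sample at time `s` of the signal `g` affected by the noise `W` and the dither
`Wd`. -/
def bit {Ω : Type*} (g : ℝ → ℝ) (W Wd : ℝ → Ω → ℝ) (s : ℝ) (ω : Ω) : ℝ :=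
  if 0 ≤ g s + W s ω + Wd s ω then 1 else 0

/-- The sampling interval `τ = 1 / (lam * N)`. -/
def tau (lam : ℝ) (N : ℕ) : ℝ := 1 / (lam * N)

/-- The interpolated one-bit samples `H_N`. -/
def H {Ω : Type*} (lam : ℝ) (g : ℝ → ℝ) (W Wd : ℝ → Ω → ℝ) (N : ℕ) (ω : Ω) (t : ℝ) : ℝ :=
  tau lam N *
    ∑' n : ℤ, (bit g W Wd (n * tau lam N) ω - 1 / 2) * phi lam (t - n * tau lam N)

/-- The clipped map `m ↦ Clip[μ h + (m - μ (F(m) - 1/2)) ⋆ φ] ⋆ φ`. -/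
def T (lam : ℝ) (v : ℝ≥0) (μ : ℝ) (h m : ℝ → ℝ) : ℝ → ℝ :=
  conv
    (fun t => clip (μ * h t + conv (fun u => m u - μ * (F v (m u) - 1 / 2)) (phi lam) t))
    (phi lam)

/-- The iterates `G_0 = 0`, `G_{k+1} = T[G_k]` of the clipped map, driven by the signal `h`. -/
def iter (lam : ℝ) (v : ℝ≥0) (μ : ℝ) (h : ℝ → ℝ) : ℕ → ℝ → ℝ
  | 0 => fun _ => 0
  | k + 1 => T lam v μ h (iter lam v μ h k)

/-- The one-bit estimate: the pointwise limit of the iterates driven by `H_N`. -/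
def Ghat {Ω : Type*} (lam : ℝ) (v : ℝ≥0) (μ : ℝ) (g : ℝ → ℝ) (W Wd : ℝ → Ω → ℝ) (N : ℕ)
    (ω : Ω) (t : ℝ) : ℝ :=
  limUnder atTop (fun k : ℕ => iter lam v μ (H lam g W Wd N ω) k t)

/-- The pointwise mean-squared error of the one-bit estimate. -/
def mse {Ω : Type*} [MeasurableSpace Ω] (P : Measure Ω) (lam : ℝ) (v : ℝ≥0) (μ : ℝ)
    (g : ℝ → ℝ) (W Wd : ℝ → Ω → ℝ) (N : ℕ) (t : ℝ) : ℝ :=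
  ∫ ω, (Ghat lam v μ g W Wd N ω t - g t) ^ 2 ∂P

/-- The distortion `D_{1-bit}`: the maximum pointwise mean-squared error. -/
def distortion {Ω : Type*} [MeasurableSpace Ω] (P : Measure Ω) (lam : ℝ) (v : ℝ≥0) (μ : ℝ)
    (g : ℝ → ℝ) (W Wd : ℝ → Ω → ℝ) (N : ℕ) : ℝ :=
  ⨆ t : ℝ, mse P lam v μ g W Wd N t

/-- The variance constant `C_2` of `H_N`. -/
def C2 (lam : ℝ) : ℝ := Cphi2 lam / (4 * lam ^ 2)

/-- The bias constant `C_3` of `H_N`. -/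
def C3 (lam : ℝ) (v : ℝ≥0) : ℝ :=
  (f v 0 * Cphi lam + (F v 1 - 1 / 2)) * Kphi lam / lam

/-- `β = 2 C_φ⁴ |1 - μ δ|²`. -/
def beta (lam : ℝ) (v : ℝ≥0) (μ : ℝ) : ℝ :=
  2 * Cphi lam ^ 4 * |1 - μ * f v (Cphi lam)| ^ 2

end OneBit

end

namespace OneBit

/-! ### The interpolation kernel -/

/-! A bit at time s has mean F(g(s)), so `H` estimates the filtered statistics `Hbar` = (F(g) - 1/2)
⋆ φ. The signal g is a fixed point of the clipped map driven by `Hbar` (`T_eq_self_of_mem_BLint`),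
the estimate is the fixed point of the same map driven by `H` (`T_iterLim`), and the proof compares
the two.

Data error. The samples are independent with variance at most 1/4, and τ²/4 times the sum of the
squared kernel samples is at most C_2/N. The bias is the error of a Riemann sum for a Lipschitz
function against φ and is at most C_3/N (`abs_bias_le`). The two contributions add as squares
(`integral_sq_H_sub_Hbar_le`).

Stability. Clipping before the last filter confines all iterates to [-C_φ, C_φ], where the density
of the noise lies between δ and Δ. There x - μ(F(x) - 1/2) has Lipschitz constant κ = 1 - μδ,
clipping is 1-Lipschitz, and each of the two filters costs a factor C_φ. Hence the map contracts the
supremum norm by κC_φ² < 1, which gives uniform convergence for every outcome.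

Mean square. The same comparison gives |Ĝ - g| ≤ |φ| ⋆ (μ|H - Hbar| + κ|φ| ⋆ |Ĝ - g|). By
Cauchy–Schwarz with weight |φ|, a filter multiplies the maximal mean square by at most C_φ²
(`integral_sq_conv_abs_le`). With (x + y)² ≤ 2x² + 2y² the distortion D satisfies D ≤ 2C_φ²μ²S + βD,
where S bounds the data error and β = 2C_φ⁴κ². The lower bound on μ says exactly that √2 C_φ²κ < 1,
so β < 1; since D is finite, the inequality can be solved for D. -/

lemma contDiff_sinc : ContDiff ℝ 2 Real.sinc := by
  rw [contDiff_iff_contDiffAt]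
  intro x
  by_cases hx : x = 0
  · subst hx
    rw [Real.sinc_eq_dslope]
    obtain ⟨p, hp⟩ := (Real.analyticAt_sin (x := 0))
    exact hp.has_fpower_series_dslope_fslope.analyticAt.contDiffAt
  · have h : Real.sinc =ᶠ[𝓝 x] fun y => Real.sin y / y := by
      filter_upwards [isOpen_ne.mem_nhds hx] with y hy
      exact Real.sinc_of_ne_zero hy
    exact (Real.contDiff_sin.contDiffAt.div contDiffAt_id hx).congr_of_eventuallyEq h

lemma mul_sinc (x : ℝ) : x * Real.sinc x = Real.sin x := by
  by_cases hx : x = 0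
  · simp [hx]
  · rw [Real.sinc_of_ne_zero hx]; field_simp

lemma abs_mul_sinc_le (x : ℝ) : |x * Real.sinc x| ≤ 1 := by
  rw [mul_sinc]; exact Real.abs_sin_le_one x

lemma hasDerivAt_sinc (x : ℝ) : HasDerivAt Real.sinc (deriv Real.sinc x) x :=
  (contDiff_sinc.differentiable (by norm_num) x).hasDerivAt

/-- Differentiating x · sinc x = sin x gives x · sinc' x = cos x - sinc x. With `abs_mul_sinc_le`
this makes φ' decay like 1/x², as φ does. -/
lemma abs_mul_deriv_sinc_le (x : ℝ) : |x * deriv Real.sinc x| ≤ 2 := by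
  have h1 : HasDerivAt (fun y : ℝ => y * Real.sinc y) (1 * Real.sinc x + x * deriv Real.sinc x) x :=
    (hasDerivAt_id x).mul (hasDerivAt_sinc x)
  have h2 : HasDerivAt (fun y : ℝ => y * Real.sinc y) (Real.cos x) x := by
    simpa only [mul_sinc] using Real.hasDerivAt_sin x
  have h3 := h1.unique h2
  have h4 : x * deriv Real.sinc x = Real.cos x - Real.sinc x := by linarith
  rw [h4]
  have := abs_sub (Real.cos x) (Real.sinc x)
  linarith [Real.abs_cos_le_one x, Real.abs_sinc_le_one x]

/-- A continuous function that is `O(1 / x²)` is bounded and integrable. -/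
lemma integrable_of_sq_mul_bound {h : ℝ → ℝ} (hc : Continuous h) {C : ℝ}
    (hC : ∀ x, |x ^ 2 * h x| ≤ C) :
    Integrable h ∧ ∃ M, ∀ x, |h x| ≤ M := by
  obtain ⟨M, hM⟩ := (isCompact_Icc (a := (-1 : ℝ)) (b := 1)).exists_bound_of_continuousOn
    hc.continuousOn
  have hb : ∀ x, |h x| ≤ M ∨ |h x| ≤ C := by
    intro x
    by_cases hx : |x| ≤ 1
    · exact Or.inl (hM x (abs_le.mp hx))
    · right
      have h1 : 1 ≤ x ^ 2 := by
        rw [← sq_abs]; nlinarith [not_le.mp hx]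
      have h2 := hC x
      rw [abs_mul, abs_of_nonneg (sq_nonneg x)] at h2
      nlinarith [abs_nonneg (h x)]
  have hM0 : 0 ≤ M := (norm_nonneg _).trans (hM 0 (by simp))
  have hC0 : 0 ≤ C := (abs_nonneg _).trans (hC 0)
  have hb' : ∀ x, |h x| ≤ M + C := fun x => by
    rcases hb x with h | h <;> linarith
  refine ⟨?_, M + C, hb'⟩
  -- (1 + x²)|h x| is at most M + C from the uniform bound plus C from the decay.
  refine (integrable_inv_one_add_sq.const_mul (M + C + C)).mono' hc.aestronglyMeasurable
    (Eventually.of_forall fun x => ?_)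
  have h2 := hC x
  rw [abs_mul, abs_of_nonneg (sq_nonneg x)] at h2
  rw [← div_eq_mul_inv, le_div_iff₀ (by positivity), Real.norm_eq_abs]
  linarith [hb' x]

variable {lam : ℝ}

lemma phi_eq_sinc (hlam : 1 < lam) (t : ℝ) :
    phi lam t = (Real.pi + (lam - 1) / 2) / Real.pi *
      (Real.sinc ((Real.pi + (lam - 1) / 2) * t) * Real.sinc ((lam - 1) / 2 * t)) := by
  have ha : 0 < (lam - 1) / 2 := by linarith
  have hpi := Real.pi_pos
  by_cases ht : t = 0
  · subst ht
    rw [phi, if_pos rfl]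
    simp only [mul_zero, Real.sinc_zero, mul_one]
    field_simp
  · have hb : Real.pi + (lam - 1) / 2 ≠ 0 := by positivity
    rw [Real.sinc_of_ne_zero (mul_ne_zero hb ht), Real.sinc_of_ne_zero (mul_ne_zero ha.ne' ht)]
    rw [phi, if_neg ht]
    generalize (lam - 1) / 2 = a at *
    field_simp

lemma contDiff_phi (hlam : 1 < lam) : ContDiff ℝ 2 (phi lam) := by
  rw [funext (phi_eq_sinc hlam)]
  exact contDiff_const.mul ((contDiff_sinc.comp (contDiff_const.mul contDiff_id)).mul
    (contDiff_sinc.comp (contDiff_const.mul contDiff_id)))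

lemma continuous_phi (hlam : 1 < lam) : Continuous (phi lam) := (contDiff_phi hlam).continuous

lemma continuous_deriv_phi (hlam : 1 < lam) : Continuous (deriv (phi lam)) :=
  (contDiff_phi hlam).continuous_deriv (by norm_num)

lemma hasDerivAt_phi (hlam : 1 < lam) (t : ℝ) : HasDerivAt (phi lam) (deriv (phi lam) t) t :=
  ((contDiff_phi hlam).differentiable (by norm_num) t).hasDerivAt

lemma integrable_phi_and_bounded (hlam : 1 < lam) :
    Integrable (phi lam) ∧ ∃ M, ∀ x, |phi lam x| ≤ M := by
  have ha : 0 < (lam - 1) / 2 := by linarith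
  have hb : 0 < Real.pi + (lam - 1) / 2 := by positivity
  refine integrable_of_sq_mul_bound (continuous_phi hlam) (C := |1 / (Real.pi * ((lam - 1) / 2))|)
    fun x => ?_
  have h : x ^ 2 * phi lam x = 1 / (Real.pi * ((lam - 1) / 2)) *
      (((Real.pi + (lam - 1) / 2) * x * Real.sinc ((Real.pi + (lam - 1) / 2) * x)) *
        ((lam - 1) / 2 * x * Real.sinc ((lam - 1) / 2 * x))) := by
    rw [phi_eq_sinc hlam]
    have hpi := Real.pi_pos.ne'
    have := ha.ne'
    generalize (lam - 1) / 2 = a at *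
    field_simp
  rw [h, abs_mul, abs_mul (_ * x * _)]
  have h1 := abs_mul_sinc_le ((Real.pi + (lam - 1) / 2) * x)
  have h2 := abs_mul_sinc_le ((lam - 1) / 2 * x)
  exact mul_le_of_le_one_right (abs_nonneg _) (mul_le_one₀ h1 (abs_nonneg _) h2)

lemma integrable_phi (hlam : 1 < lam) : Integrable (phi lam) :=
  (integrable_phi_and_bounded hlam).1

lemma integrable_deriv_phi (hlam : 1 < lam) : Integrable (deriv (phi lam)) := by
  have ha : 0 < (lam - 1) / 2 := by linarith
  have hb : 0 < Real.pi + (lam - 1) / 2 := by positivity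
  have hpi := Real.pi_pos
  have hd : ∀ x, deriv (phi lam) x = (Real.pi + (lam - 1) / 2) / Real.pi *
      ((deriv Real.sinc ((Real.pi + (lam - 1) / 2) * x) * (Real.pi + (lam - 1) / 2)) *
        Real.sinc ((lam - 1) / 2 * x) + Real.sinc ((Real.pi + (lam - 1) / 2) * x) *
        (deriv Real.sinc ((lam - 1) / 2 * x) * ((lam - 1) / 2))) := by
    intro x
    rw [funext (phi_eq_sinc hlam)]
    have hs : ∀ c : ℝ, HasDerivAt (fun t => Real.sinc (c * t)) (deriv Real.sinc (c * x) * c) x :=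
      fun c => (hasDerivAt_sinc (c * x)).comp x (by simpa using (hasDerivAt_id x).const_mul c)
    exact (((hs _).mul (hs _)).const_mul _).deriv
  generalize hA : (lam - 1) / 2 = a at *
  refine (integrable_of_sq_mul_bound (continuous_deriv_phi hlam)
    (C := (Real.pi + a) / Real.pi * (2 / a + 2 / (Real.pi + a))) fun x => ?_).1
  have h : x ^ 2 * deriv (phi lam) x = (Real.pi + a) / Real.pi *
      ((((Real.pi + a) * x * deriv Real.sinc ((Real.pi + a) * x)) *
        (a * x * Real.sinc (a * x))) / a +
       (((Real.pi + a) * x * Real.sinc ((Real.pi + a) * x)) *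
        (a * x * deriv Real.sinc (a * x))) / (Real.pi + a)) := by
    rw [hd]
    field_simp
  rw [h, abs_mul, abs_of_pos (by positivity : 0 < (Real.pi + a) / Real.pi)]
  refine mul_le_mul_of_nonneg_left ((abs_add_le _ _).trans ?_) (by positivity)
  rw [abs_div, abs_div, abs_of_pos ha, abs_of_pos hb, abs_mul, abs_mul (_ * x * Real.sinc _)]
  have h1 := abs_mul_sinc_le ((Real.pi + a) * x)
  have h2 := abs_mul_sinc_le (a * x)
  have h3 := abs_mul_deriv_sinc_le ((Real.pi + a) * x)
  have h4 := abs_mul_deriv_sinc_le (a * x)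
  gcongr
  · nlinarith [abs_nonneg (a * x * Real.sinc (a * x))]
  · nlinarith [abs_nonneg (a * x * deriv Real.sinc (a * x))]

/-- The zeros lie on two arithmetic progressions. This allows division by the kernel when the
measurability of a signal is recovered from that of its product with φ. -/
lemma ae_phi_ne_zero (hlam : 1 < lam) : ∀ᵐ t, phi lam t ≠ 0 := by
  have ha : 0 < (lam - 1) / 2 := by linarith
  have hb : 0 < Real.pi + (lam - 1) / 2 := by positivity
  have hc : ∀ c : ℝ, 0 < c → {t : ℝ | Real.sin (c * t) = 0}.Countable := by
    intro c hc
    refine (Set.countable_range fun n : ℤ => (n : ℝ) * Real.pi / c).mono ?_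
    intro t ht
    obtain ⟨n, hn⟩ := Real.sin_eq_zero_iff.mp ht
    exact ⟨n, by simp only [hn]; field_simp⟩
  have h := ((hc _ ha).union (hc _ hb)).measure_zero volume
  refine (measure_eq_zero_iff_ae_notMem.mp h).mono fun t ht => ?_
  simp only [Set.mem_union, Set.mem_ofPred_eq, not_or] at ht
  have ht0 : t ≠ 0 := by rintro rfl; simp at ht
  rw [phi, if_neg ht0]
  have hpi := Real.pi_pos
  exact mul_ne_zero (by positivity) (mul_ne_zero ht.2 ht.1)

lemma Cphi_nonneg (lam : ℝ) : 0 ≤ Cphi lam := integral_nonneg fun _ => abs_nonneg _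

lemma Kphi_nonneg (lam : ℝ) : 0 ≤ Kphi lam := integral_nonneg fun _ => abs_nonneg _

/-! ### Riemann sums -/

/-- Additivity of the integral over the cells `(nτ, (n+1)τ]`. -/
lemma hasSum_integral_cells {τ : ℝ} (hτ : 0 < τ) {h : ℝ → ℝ} (hh : Integrable h) :
    HasSum (fun n : ℤ => ∫ u in (n * τ)..((n + 1) * τ), h u) (∫ u, h u) := by
  have hU := iUnion_Ioc_zsmul hτ
  have h1 := hasSum_integral_iUnion (μ := volume) (f := h)
    (s := fun n : ℤ => Set.Ioc (n • τ) ((n + 1) • τ)) (fun n => measurableSet_Ioc)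
    (Set.pairwise_disjoint_Ioc_zsmul τ) (by rw [hU]; exact hh.integrableOn)
  rw [hU, setIntegral_univ] at h1
  have h2 : (fun n : ℤ => ∫ u in (n * τ)..((n + 1) * τ), h u) =
      fun n : ℤ => ∫ u in Set.Ioc (n • τ) ((n + 1) • τ), h u := by
    ext n
    rw [intervalIntegral.integral_of_le (by nlinarith)]
    simp
  rw [h2]
  exact h1

/-- On a cell, an absolutely continuous function moves by at most the integral of its derivative. -/
lemma abs_sub_le_integral_cell {ψ : ℝ → ℝ} (hψ : ContDiff ℝ 1 ψ) {a b u : ℝ}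
    (hau : a ≤ u) (hub : u ≤ b) : |ψ u - ψ a| ≤ ∫ s in a..b, |deriv ψ s| := by
  have hc := hψ.continuous_deriv le_rfl
  have h1 : ∫ s in a..u, deriv ψ s = ψ u - ψ a :=
    intervalIntegral.integral_deriv_eq_sub
      (fun x _ => hψ.differentiable (by norm_num) x) (hc.intervalIntegrable _ _)
  rw [← h1]
  refine (intervalIntegral.abs_integral_le_integral_abs hau).trans ?_
  exact intervalIntegral.integral_mono_interval le_rfl hau hub
    (Eventually.of_forall fun _ => abs_nonneg _) (hc.abs.intervalIntegrable _ _)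

/-- Sums of samples are controlled by the integrals of the function and of its derivative. -/
lemma summable_samples {τ : ℝ} (hτ : 0 < τ) {ψ : ℝ → ℝ} (hψ : ContDiff ℝ 1 ψ)
    (hi : Integrable ψ) (hi' : Integrable (deriv ψ)) :
    Summable (fun n : ℤ => |ψ (n * τ)|) ∧
      τ * ∑' n : ℤ, |ψ (n * τ)| ≤ (∫ u, |ψ u|) + τ * ∫ u, |deriv ψ u| := by
  have hc := hψ.continuous_deriv le_rfl
  have hs := (hasSum_integral_cells hτ hi.abs).add ((hasSum_integral_cells hτ hi'.abs).mul_left τ)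
  -- For every u in the cell, |ψ(nτ)| exceeds |ψ(u)| by at most the integral of |ψ'| over the cell;
  -- integrate over u.
  have hb : ∀ n : ℤ, τ * |ψ (n * τ)| ≤ (∫ u in (n * τ)..((n + 1) * τ), |ψ u|) +
      τ * ∫ u in (n * τ)..((n + 1) * τ), |deriv ψ u| := by
    intro n
    have hle : (n : ℝ) * τ ≤ (n + 1) * τ := by nlinarith
    have h1 := intervalIntegral.integral_mono_on (μ := volume) hle (f := fun _ => |ψ (n * τ)|)
      (g := fun u => |ψ u| + ∫ u in (n * τ)..((n + 1) * τ), |deriv ψ u|)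
      (intervalIntegrable_const) ((hψ.continuous.abs.add continuous_const).intervalIntegrable _ _)
      (fun u hu => by
        have h2 := abs_sub_le_integral_cell hψ hu.1 hu.2
        have h3 := abs_sub_abs_le_abs_sub (ψ (n * τ)) (ψ u)
        rw [abs_sub_comm] at h3
        linarith)
    rw [intervalIntegral.integral_add (hψ.continuous.abs.intervalIntegrable _ _)
      intervalIntegrable_const, intervalIntegral.integral_const,
      intervalIntegral.integral_const, smul_eq_mul, smul_eq_mul] at h1
    have h4 : ((n : ℝ) + 1) * τ - n * τ = τ := by ring
    rwa [h4] at h1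
  have hsum : Summable (fun n : ℤ => τ * |ψ (n * τ)|) :=
    Summable.of_nonneg_of_le (fun n => by positivity) hb hs.summable
  refine ⟨(summable_mul_left_iff hτ.ne').mp hsum, ?_⟩
  rw [← tsum_mul_left, ← hs.tsum_eq]
  exact hsum.tsum_le_tsum hb hs.summable

/-- The error of a Riemann sum for the product of a Lipschitz function and an integrable `C¹`
function. -/
lemma abs_riemann_sum_sub_integral_le {τ : ℝ} (hτ : 0 < τ) {ψ : ℝ → ℝ} (hψ : ContDiff ℝ 1 ψ)
    (hi : Integrable ψ) (hi' : Integrable (deriv ψ)) {p : ℝ → ℝ} {L B : ℝ}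
    (hL : ∀ x y, |p x - p y| ≤ L * |x - y|) (hL0 : 0 ≤ L) (hB : ∀ x, |p x| ≤ B) :
    |τ * (∑' n : ℤ, p (n * τ) * ψ (n * τ)) - ∫ u, p u * ψ u| ≤
      τ * (L * (∫ u, |ψ u|) + B * ∫ u, |deriv ψ u|) := by
  have hB0 : 0 ≤ B := (abs_nonneg _).trans (hB 0)
  have hpc : Continuous p :=
    (LipschitzWith.of_dist_le_mul (K := L.toNNReal) fun x y => by
      simpa [Real.dist_eq, Real.coe_toNNReal L hL0] using hL x y).continuous
  have hpi : Integrable (fun u => p u * ψ u) :=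
    hi.bdd_mul hpc.aestronglyMeasurable (Eventually.of_forall hB)
  have hs := ((hasSum_integral_cells hτ hi.abs).mul_left (τ * L)).add
    ((hasSum_integral_cells hτ hi'.abs).mul_left (τ * B))
  have hsp := hasSum_integral_cells hτ hpi
  have hsm : Summable fun n : ℤ => p (n * τ) * ψ (n * τ) := by
    refine ((summable_samples hτ hψ hi hi').1.mul_left B).of_norm_bounded fun n => ?_
    rw [Real.norm_eq_abs, abs_mul]
    exact mul_le_mul_of_nonneg_right (hB _) (abs_nonneg _)
  have hd := (hsm.hasSum.mul_left τ).sub hsp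
  have hb : ∀ n : ℤ, |τ * (p (n * τ) * ψ (n * τ)) -
      ∫ u in (n * τ)..((n + 1) * τ), p u * ψ u| ≤
      τ * L * (∫ u in (n * τ)..((n + 1) * τ), |ψ u|) +
        τ * B * ∫ u in (n * τ)..((n + 1) * τ), |deriv ψ u| := by
    intro n
    have hle : (n : ℝ) * τ ≤ (n + 1) * τ := by nlinarith
    have h4 : ((n : ℝ) + 1) * τ - n * τ = τ := by ring
    have h1 : τ * (p (n * τ) * ψ (n * τ)) - ∫ u in (n * τ)..((n + 1) * τ), p u * ψ u =
        ∫ u in (n * τ)..((n + 1) * τ), (p (n * τ) * ψ (n * τ) - p u * ψ u) := by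
      rw [intervalIntegral.integral_sub (g := fun u => p u * ψ u) intervalIntegrable_const
        ((hpc.mul hψ.continuous).intervalIntegrable _ _), intervalIntegral.integral_const, h4,
        smul_eq_mul]
    rw [h1]
    refine (intervalIntegral.abs_integral_le_integral_abs hle).trans ?_
    have h5 := intervalIntegral.integral_mono_on (μ := volume) hle
      (f := fun u => |p (n * τ) * ψ (n * τ) - p u * ψ u|)
      (g := fun u => τ * L * |ψ u| + B * ∫ u in (n * τ)..((n + 1) * τ), |deriv ψ u|)
      (((continuous_const.sub (hpc.mul hψ.continuous)).abs).intervalIntegrable _ _)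
      (((continuous_const.mul hψ.continuous.abs).add continuous_const).intervalIntegrable _ _)
      (fun u hu => by
        have h2 := abs_sub_le_integral_cell hψ hu.1 hu.2
        -- Pairing the increment of p with ψ at the running point u yields the integral of |ψ|
        -- itself, not a sum of samples.
        have h3 : p (n * τ) * ψ (n * τ) - p u * ψ u =
          (p (n * τ) - p u) * ψ u - p (n * τ) * (ψ u - ψ (n * τ)) := by ring
        rw [h3]
        refine (abs_sub _ _).trans ?_
        rw [abs_mul, abs_mul]
        have h6 : |p (n * τ) - p u| ≤ τ * L := by
          refine (hL _ _).trans ?_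
          rw [mul_comm τ]
          refine mul_le_mul_of_nonneg_left ?_ hL0
          rw [abs_sub_comm, abs_of_nonneg (by linarith [hu.1])]
          linarith [hu.2]
        exact add_le_add (mul_le_mul_of_nonneg_right h6 (abs_nonneg _))
          (mul_le_mul (hB _) h2 (abs_nonneg _) hB0))
    rw [intervalIntegral.integral_add (f := fun u => τ * L * |ψ u|)
      ((continuous_const.mul hψ.continuous.abs).intervalIntegrable _ _) intervalIntegrable_const,
      intervalIntegral.integral_const, intervalIntegral.integral_const_mul, h4, smul_eq_mul] at h5
    linarith
  rw [← hd.tsum_eq]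
  refine (tsum_of_norm_bounded (f := fun n : ℤ => τ * (p (n * τ) * ψ (n * τ)) -
    ∫ u in (n * τ)..((n + 1) * τ), p u * ψ u) hs hb).trans (le_of_eq ?_)
  ring

/-! ### Integrals and samples of the translated kernel. -/

lemma contDiff_phi_sub (hlam : 1 < lam) (t : ℝ) : ContDiff ℝ 1 (fun u => phi lam (t - u)) :=
  ((contDiff_phi hlam).of_le (by norm_num)).comp (contDiff_const.sub contDiff_id)

lemma deriv_phi_sub (t : ℝ) :
    deriv (fun u => phi lam (t - u)) = fun u => -deriv (phi lam) (t - u) := by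
  ext u
  exact deriv_comp_const_sub ..

lemma integrable_phi_sub (hlam : 1 < lam) (t : ℝ) : Integrable (fun u => phi lam (t - u)) :=
  (integrable_phi hlam).comp_sub_left t

lemma integrable_deriv_phi_sub (hlam : 1 < lam) (t : ℝ) :
    Integrable (deriv fun u => phi lam (t - u)) := by
  rw [deriv_phi_sub]
  exact ((integrable_deriv_phi hlam).comp_sub_left t).neg

lemma integral_abs_phi_sub (lam t : ℝ) : ∫ u, |phi lam (t - u)| = Cphi lam :=
  integral_sub_left_eq_self (fun u => |phi lam u|) volume t

lemma integral_abs_deriv_phi_sub (lam t : ℝ) :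
    ∫ u, |deriv (fun u => phi lam (t - u)) u| = Kphi lam := by
  simp only [deriv_phi_sub, abs_neg]
  exact integral_sub_left_eq_self (fun u => |deriv (phi lam) u|) volume t

lemma summable_abs_phi_samples (hlam : 1 < lam) {τ : ℝ} (hτ : 0 < τ) (t : ℝ) :
    Summable (fun n : ℤ => |phi lam (t - n * τ)|) :=
  (summable_samples hτ (contDiff_phi_sub hlam t) (integrable_phi_sub hlam t)
    (integrable_deriv_phi_sub hlam t)).1

lemma tsum_abs_phi_samples_le (hlam : 1 < lam) {τ : ℝ} (hτ : 0 < τ) (t : ℝ) :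
    τ * ∑' n : ℤ, |phi lam (t - n * τ)| ≤ Cphi lam + τ * Kphi lam := by
  rw [← integral_abs_phi_sub lam t, ← integral_abs_deriv_phi_sub lam t]
  exact (summable_samples hτ (contDiff_phi_sub hlam t) (integrable_phi_sub hlam t)
    (integrable_deriv_phi_sub hlam t)).2

lemma summable_sq_phi_samples (hlam : 1 < lam) {τ : ℝ} (hτ : 0 < τ) (t : ℝ) :
    Summable (fun n : ℤ => |phi lam (t - n * τ)| ^ 2) := by
  obtain ⟨M, hM⟩ := (integrable_phi_and_bounded hlam).2
  refine ((summable_abs_phi_samples hlam hτ t).mul_left M).of_nonneg_of_le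
    (fun _ => by positivity) fun n => ?_
  rw [sq]
  exact mul_le_mul_of_nonneg_right (hM _) (abs_nonneg _)

/-- A real supremum over an unbounded family is 0 by convention, so `Cphi2` bounds the sums only
once they are known to be bounded. This follows from φ² ≤ M|φ| and the uniform bound on sums of |φ|.
-/
lemma bddAbove_tsum_sq_phi (hlam : 1 < lam) :
    BddAbove (Set.range fun t : ℝ => ∑' k : ℤ, |phi lam (t - (k : ℝ) / lam)| ^ 2) := by
  have hτ : 0 < lam⁻¹ := by positivity
  obtain ⟨M, hM⟩ := (integrable_phi_and_bounded hlam).2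
  have hM0 : 0 ≤ M := (abs_nonneg _).trans (hM 0)
  refine ⟨M * ((Cphi lam + lam⁻¹ * Kphi lam) / lam⁻¹), ?_⟩
  rintro _ ⟨t, rfl⟩
  simp only [div_eq_mul_inv]
  have h1 : ∑' n : ℤ, |phi lam (t - n * lam⁻¹)| ^ 2 ≤
      ∑' n : ℤ, M * |phi lam (t - n * lam⁻¹)| := by
    refine (summable_sq_phi_samples hlam hτ t).tsum_le_tsum (fun n => ?_)
      ((summable_abs_phi_samples hlam hτ t).mul_left M)
    rw [sq]
    exact mul_le_mul_of_nonneg_right (hM _) (abs_nonneg _)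
  rw [tsum_mul_left] at h1
  refine h1.trans (mul_le_mul_of_nonneg_left ?_ hM0)
  rw [← div_eq_mul_inv, le_div_iff₀ hτ, mul_comm]
  exact tsum_abs_phi_samples_le hlam hτ t

/-- The squared samples on the grid of step `1 / (lam * N)` split into `N` grids of step
`1 / lam`. -/
lemma tsum_sq_phi_samples_le (hlam : 1 < lam) {N : ℕ} (hN : 1 ≤ N) (t : ℝ) :
    ∑' n : ℤ, |phi lam (t - n * tau lam N)| ^ 2 ≤ N * Cphi2 lam := by
  have hτ : 0 < tau lam N := by
    have : (0 : ℝ) < N := by exact_mod_cast hN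
    unfold tau; positivity
  have : NeZero N := ⟨by omega⟩
  have hN0 : (N : ℝ) ≠ 0 := by exact_mod_cast (by omega : N ≠ 0)
  let e : ℤ ≃ ℤ × Fin N := Int.divModEquiv N
  have hs := summable_sq_phi_samples hlam hτ t
  rw [← e.symm.tsum_eq (fun n : ℤ => |phi lam (t - n * tau lam N)| ^ 2)]
  have hs' := e.symm.summable_iff.mpr hs
  have hs'' : Summable fun q : Fin N × ℤ =>
      |phi lam (t - (e.symm q.swap : ℤ) * tau lam N)| ^ 2 :=
    (Equiv.prodComm (Fin N) ℤ).summable_iff.mpr hs'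
  have h1 : ∑' q : ℤ × Fin N, |phi lam (t - (e.symm q : ℤ) * tau lam N)| ^ 2 =
      ∑' q : Fin N × ℤ, |phi lam (t - (e.symm q.swap : ℤ) * tau lam N)| ^ 2 :=
    ((Equiv.prodComm (Fin N) ℤ).tsum_eq
      (fun q : ℤ × Fin N => |phi lam (t - (e.symm q : ℤ) * tau lam N)| ^ 2)).symm
  rw [h1, hs''.tsum_prod, tsum_fintype]
  refine (Finset.sum_le_card_nsmul Finset.univ _ (Cphi2 lam) fun j _ => ?_).trans (by simp)
  -- Write n = j + kN. As Nτ = 1/λ, the residue class j is the grid of step 1/λ seen from the point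
  -- t - jτ.
  have h2 := le_ciSup (bddAbove_tsum_sq_phi hlam) (t - j * tau lam N)
  refine (le_of_eq (tsum_congr fun k => ?_)).trans h2
  have h3 : (e.symm (j, k).swap : ℤ) = j + k * N := by
    simp [e, Int.divModEquiv]
    ring
  rw [h3]
  congr 3
  push_cast
  unfold tau
  field_simp
  ring

end OneBit

namespace OneBit

/-! ### The noise distribution -/

variable {lam : ℝ} {v : ℝ≥0} {μ : ℝ}

lemma F_eq_real (v : ℝ≥0) (x : ℝ) : F v x = (gaussianReal 0 v).real (Set.Iic x) :=
  cdf_eq_real _ _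

lemma F_mono (v : ℝ≥0) : Monotone (F v) := fun _ _ h => monotone_cdf _ h

lemma F_nonneg (v : ℝ≥0) (x : ℝ) : 0 ≤ F v x := cdf_nonneg _ _

lemma F_le_one (v : ℝ≥0) (x : ℝ) : F v x ≤ 1 := cdf_le_one _ _

lemma abs_F_sub_half_le (v : ℝ≥0) (x : ℝ) : |F v x - 1 / 2| ≤ 1 / 2 := by
  rw [abs_le]; constructor <;> linarith [F_nonneg v x, F_le_one v x]

lemma gaussianReal_real_Ici_neg (v : ℝ≥0) (x : ℝ) :
    (gaussianReal 0 v).real (Set.Ici (-x)) = F v x := by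
  have h := gaussianReal_map_neg (μ := 0) (v := v)
  rw [neg_zero] at h
  rw [F_eq_real, ← h, map_measureReal_apply measurable_neg measurableSet_Ici, h]
  congr 1
  ext y
  simp

lemma F_neg (hv : v ≠ 0) (x : ℝ) : F v (-x) = 1 - F v x := by
  have := nullSingletonClass_gaussianReal (μ := 0) hv
  rw [← gaussianReal_real_Ici_neg v x, F_eq_real,
    measureReal_congr (Iio_ae_eq_Iic (a := -x)).symm,
    ← probReal_compl_eq_one_sub measurableSet_Ici, Set.compl_Ici]

lemma F_sub_eq_integral (hv : v ≠ 0) (x y : ℝ) :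
    F v x - F v y = ∫ u in y..x, f v u := by
  have h1 : ∀ z, F v z = ∫ u in Set.Iic z, f v u := by
    intro z
    rw [F_eq_real, measureReal_def, gaussianReal_apply_eq_integral _ hv, ENNReal.toReal_ofReal]
    · rfl
    · exact integral_nonneg fun _ => gaussianPDFReal_nonneg _ _ _
  rw [h1, h1]
  exact intervalIntegral.integral_Iic_sub_Iic (integrable_gaussianPDFReal _ _).integrableOn
    (integrable_gaussianPDFReal _ _).integrableOn

lemma f_pos (hv : v ≠ 0) (x : ℝ) : 0 < f v x := gaussianPDFReal_pos _ _ _ hv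

lemma f_le_of_abs_le {x y : ℝ} (h : |x| ≤ |y|) : f v y ≤ f v x := by
  unfold f
  rw [gaussianPDFReal_def]
  simp only [sub_zero]
  refine mul_le_mul_of_nonneg_left (Real.exp_le_exp.mpr ?_) (by positivity)
  have := sq_le_sq.mpr h
  gcongr

lemma continuous_f (v : ℝ≥0) : Continuous (f v) := by
  unfold f
  rw [gaussianPDFReal_def]
  fun_prop

lemma F_sub_le (hv : v ≠ 0) {x y : ℝ} (h : y ≤ x) : F v x - F v y ≤ f v 0 * (x - y) := by
  rw [F_sub_eq_integral hv]
  have := intervalIntegral.integral_mono_on (μ := volume) h (g := fun _ => f v 0)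
    ((continuous_f v).intervalIntegrable _ _) intervalIntegrable_const
    (fun u _ => f_le_of_abs_le (by simp))
  rwa [intervalIntegral.integral_const, smul_eq_mul, mul_comm] at this

lemma le_F_sub (hv : v ≠ 0) {x y C : ℝ} (h : y ≤ x) (hx : |x| ≤ C) (hy : |y| ≤ C) :
    f v C * (x - y) ≤ F v x - F v y := by
  rw [F_sub_eq_integral hv]
  have := intervalIntegral.integral_mono_on (μ := volume) h (f := fun _ => f v C)
    intervalIntegrable_const ((continuous_f v).intervalIntegrable _ _)
    (fun u hu => f_le_of_abs_le (by
      refine le_trans ?_ (le_abs_self C)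
      exact abs_le.mpr ⟨by linarith [(abs_le.mp hy).1, hu.1], by linarith [(abs_le.mp hx).2, hu.2]⟩))
  rwa [intervalIntegral.integral_const, smul_eq_mul, mul_comm] at this

lemma abs_F_sub_le (hv : v ≠ 0) (x y : ℝ) : |F v x - F v y| ≤ f v 0 * |x - y| := by
  wlog h : y ≤ x generalizing x y
  · rw [abs_sub_comm, abs_sub_comm x]
    exact this y x (le_of_not_ge h)
  rw [abs_of_nonneg (sub_nonneg.mpr (F_mono v h)), abs_of_nonneg (sub_nonneg.mpr h)]
  exact F_sub_le hv h

/-- The symmetry F(-1) = 1 - F(1) gives the constant F(1) - 1/2 that enters C_3, in place of the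
trivial 1/2. -/
lemma abs_F_sub_half_le_of_abs_le_one (hv : v ≠ 0) {x : ℝ} (hx : |x| ≤ 1) :
    |F v x - 1 / 2| ≤ F v 1 - 1 / 2 := by
  have h := F_neg hv 1
  rw [abs_le] at hx ⊢
  constructor <;> linarith [F_mono v hx.1, F_mono v hx.2]

/-- Under the variance condition the map `x ↦ x - μ (F x - 1/2)` contracts on `[-C, C]`. -/
lemma abs_sub_sub_mul_F_le (hv : v ≠ 0) (hμ : 0 < μ) (hμ' : μ * f v 0 ≤ 1) {x y C : ℝ}
    (hx : |x| ≤ C) (hy : |y| ≤ C) :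
    |(x - μ * (F v x - 1 / 2)) - (y - μ * (F v y - 1 / 2))| ≤ (1 - μ * f v C) * |x - y| := by
  wlog h : y ≤ x generalizing x y
  · rw [abs_sub_comm, abs_sub_comm x]
    exact this hy hx (le_of_not_ge h)
  -- The upper bound Δ on the density, with μΔ ≤ 1, keeps the map monotone, so the absolute value
  -- can be dropped; the lower bound δ then gives the factor.
  have h1 := mul_le_mul_of_nonneg_left (F_sub_le hv h) hμ.le
  have h2 := mul_le_mul_of_nonneg_left (le_F_sub hv h hx hy) hμ.le
  have h3 := mul_le_mul_of_nonneg_right hμ' (sub_nonneg.mpr h)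
  rw [abs_of_nonneg (sub_nonneg.mpr h), abs_of_nonneg] <;> nlinarith

lemma VarianceCondition.mul_f_zero_lt_one (hv : v ≠ 0) (h : VarianceCondition lam v μ) :
    μ * f v 0 < 1 := (lt_div_iff₀ (f_pos hv 0)).mp h.2

lemma VarianceCondition.one_sub_nonneg (hv : v ≠ 0) (hμ : 0 < μ) (h : VarianceCondition lam v μ) :
    0 ≤ 1 - μ * f v (Cphi lam) := by
  have h1 := h.mul_f_zero_lt_one hv
  have h2 : f v (Cphi lam) ≤ f v 0 := f_le_of_abs_le (by simp)
  have := mul_le_mul_of_nonneg_left h2 hμ.le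
  linarith

/-- This is the lower bound on μ solved for 1 - μδ. Its square is the statement β < 1, and dropping
√2 ≥ 1 gives the contraction in the supremum norm. -/
lemma VarianceCondition.sqrt_two_mul_lt_one (hv : v ≠ 0)
    (h : VarianceCondition lam v μ) :
    Real.sqrt 2 * (Cphi lam ^ 2 * (1 - μ * f v (Cphi lam))) < 1 := by
  rcases (Cphi_nonneg lam).eq_or_lt with h0 | h0
  · simp [← h0]
  · have h1 := h.1
    rw [mul_one_div, div_lt_iff₀ (f_pos hv _)] at h1
    have h2 : 1 - μ * f v (Cphi lam) < 1 / (Real.sqrt 2 * Cphi lam ^ 2) := by linarith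
    rw [lt_div_iff₀ (by positivity)] at h2
    linarith

lemma VarianceCondition.beta_lt_one (hv : v ≠ 0) (hμ : 0 < μ) (h : VarianceCondition lam v μ) :
    beta lam v μ < 1 := by
  have h1 := h.sqrt_two_mul_lt_one hv
  have h2 := h.one_sub_nonneg hv hμ
  have h3 : beta lam v μ = (Real.sqrt 2 * (Cphi lam ^ 2 * (1 - μ * f v (Cphi lam)))) ^ 2 := by
    rw [beta, sq_abs, mul_pow, Real.sq_sqrt (by norm_num)]
    ring
  rw [h3]
  exact pow_lt_one₀ (by positivity) h1 (by norm_num)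

lemma VarianceCondition.contraction_lt_one (hv : v ≠ 0) (hμ : 0 < μ)
    (h : VarianceCondition lam v μ) : (1 - μ * f v (Cphi lam)) * Cphi lam * Cphi lam < 1 := by
  have h1 := h.sqrt_two_mul_lt_one hv
  have h2 := h.one_sub_nonneg hv hμ
  have h3 : (1 : ℝ) ≤ Real.sqrt 2 := Real.one_le_sqrt.mpr (by norm_num)
  have h4 : 0 ≤ Cphi lam ^ 2 * (1 - μ * f v (Cphi lam)) := by positivity
  nlinarith

/-! ### Clipping -/

/-- In this form clipping is visibly 1-Lipschitz and measurable. -/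
lemma clip_eq (x : ℝ) : clip x = max (-1) (min 1 x) := by
  unfold clip
  split_ifs with h
  · rw [abs_le] at h
    rw [min_eq_right h.2, max_eq_right h.1]
  · rw [abs_le, not_and_or, not_le, not_le] at h
    rcases h with h | h
    · rw [Real.sign_of_neg (by linarith), min_eq_right (by linarith), max_eq_left h.le]
    · rw [Real.sign_of_pos (by linarith), min_eq_left h.le, max_eq_right (by norm_num)]

lemma abs_clip_le (x : ℝ) : |clip x| ≤ 1 := by
  rw [clip_eq, abs_le]
  exact ⟨le_max_left _ _, max_le (by norm_num) (min_le_left _ _)⟩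

lemma abs_clip_sub_le (x y : ℝ) : |clip x - clip y| ≤ |x - y| := by
  rw [clip_eq, clip_eq]
  refine (abs_max_sub_max_le_max _ _ _ _).trans ?_
  rw [sub_self, abs_zero, max_eq_right (abs_nonneg _)]
  simpa using abs_min_sub_min_le_max 1 x 1 y

lemma measurable_clip : Measurable clip := by
  rw [funext clip_eq]
  fun_prop

lemma clip_of_abs_le {x : ℝ} (h : |x| ≤ 1) : clip x = x := if_pos h

/-! ### Convolution with the kernel -/

lemma conv_apply (m k : ℝ → ℝ) (t : ℝ) : conv m k t = ∫ u, m u * k (t - u) := rfl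

lemma integrable_mul_phi (hlam : 1 < lam) {m : ℝ → ℝ} (hm : Measurable m) {M : ℝ}
    (hM : ∀ t, |m t| ≤ M) (t : ℝ) : Integrable (fun u => m u * phi lam (t - u)) :=
  (integrable_phi_sub hlam t).bdd_mul hm.aestronglyMeasurable (Eventually.of_forall hM)

lemma integrable_mul_abs_phi (hlam : 1 < lam) {m : ℝ → ℝ} (hm : Measurable m) {M : ℝ}
    (hM : ∀ t, |m t| ≤ M) (t : ℝ) : Integrable (fun u => m u * |phi lam (t - u)|) :=
  (integrable_phi_sub hlam t).abs.bdd_mul hm.aestronglyMeasurable (Eventually.of_forall hM)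

/-- No measurability of m is needed, because the integral of a non-integrable product is 0 by
convention. -/
lemma abs_conv_le (hlam : 1 < lam) {m : ℝ → ℝ} {M : ℝ} (hM : ∀ t, |m t| ≤ M) (t : ℝ) :
    |conv m (phi lam) t| ≤ M * Cphi lam := by
  rw [conv_apply, ← integral_abs_phi_sub lam t, ← integral_const_mul]
  refine norm_integral_le_of_norm_le (f := fun u => m u * phi lam (t - u))
    ((integrable_phi_sub hlam t).abs.const_mul M)
    (Eventually.of_forall fun u => ?_)
  rw [Real.norm_eq_abs, abs_mul]
  exact mul_le_mul_of_nonneg_right (hM u) (abs_nonneg _)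

lemma conv_sub (hlam : 1 < lam) {m m' : ℝ → ℝ} (hm : Measurable m) (hm' : Measurable m') {M : ℝ}
    (hM : ∀ t, |m t| ≤ M) (hM' : ∀ t, |m' t| ≤ M) (t : ℝ) :
    conv m (phi lam) t - conv m' (phi lam) t = conv (fun u => m u - m' u) (phi lam) t := by
  simp only [conv_apply, sub_mul]
  exact (integral_sub (integrable_mul_phi hlam hm hM t) (integrable_mul_phi hlam hm' hM' t)).symm

lemma abs_conv_le_integral (m : ℝ → ℝ) (t : ℝ) :
    |conv m (phi lam) t| ≤ ∫ u, |m u| * |phi lam (t - u)| := by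
  rw [conv_apply]
  simp only [← abs_mul]
  exact abs_integral_le_integral_abs

/-- Convolution with `φ` preserves joint measurability in a parameter. -/
lemma measurable_conv_uncurry (hlam : 1 < lam) {α : Type*} [MeasurableSpace α] {m : α → ℝ → ℝ}
    (hm : Measurable (Function.uncurry m)) :
    Measurable (Function.uncurry fun a t => conv (m a) (phi lam) t) := by
  have h : StronglyMeasurable (Function.uncurry fun (p : α × ℝ) (u : ℝ) =>
      m p.1 u * phi lam (p.2 - u)) := by
    refine Measurable.stronglyMeasurable ?_
    have h1 : Measurable fun q : (α × ℝ) × ℝ => m q.1.1 q.2 :=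
      hm.comp (measurable_fst.fst.prodMk measurable_snd)
    exact h1.mul ((continuous_phi hlam).measurable.comp
      (measurable_fst.snd.sub measurable_snd))
  exact h.integral_prod_right.measurable

/-- Translates of the kernel are Lipschitz in `L¹`. -/
lemma integral_abs_phi_sub_sub_le (hlam : 1 < lam) (s t : ℝ) :
    ∫ u, |phi lam (t - u) - phi lam (s - u)| ≤ Kphi lam * |t - s| := by
  wlog h : s ≤ t generalizing s t
  · have := this t s (le_of_not_ge h)
    simpa only [abs_sub_comm] using this
  have hint : Integrable (Function.uncurry fun u x => |deriv (phi lam) (x - u)|)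
      (volume.prod (volume.restrict (Set.Ioc s t))) := by
    have hc : Continuous (Function.uncurry fun u x => |deriv (phi lam) (x - u)|) := by
      have := continuous_deriv_phi hlam
      exact (this.comp (continuous_snd.sub continuous_fst)).abs
    rw [integrable_prod_iff' hc.aestronglyMeasurable]
    refine ⟨Eventually.of_forall fun x => ((integrable_deriv_phi hlam).comp_sub_left x).abs, ?_⟩
    have : (fun x : ℝ => ∫ u, ‖Function.uncurry (fun u x => |deriv (phi lam) (x - u)|) (u, x)‖) =
        fun _ => Kphi lam := by
      ext x
      simp only [Function.uncurry_apply_pair, Real.norm_eq_abs, abs_abs]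
      exact integral_sub_left_eq_self (fun u => |deriv (phi lam) u|) volume x
    rw [this]
    exact integrable_const _
  -- The increment is the integral of φ'(x - u) over x in (s, t]. After exchanging the integrals,
  -- each x contributes K_φ.
  have h1 : ∀ u, |phi lam (t - u) - phi lam (s - u)| ≤
      ∫ x in Set.Ioc s t, |deriv (phi lam) (x - u)| := by
    intro u
    have h2 : ∫ x in s..t, deriv (phi lam) (x - u) = phi lam (t - u) - phi lam (s - u) := by
      rw [intervalIntegral.integral_comp_sub_right (fun x => deriv (phi lam) x)]
      exact intervalIntegral.integral_deriv_eq_sub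
        (fun x _ => (hasDerivAt_phi hlam x).differentiableAt)
        ((continuous_deriv_phi hlam).intervalIntegrable _ _)
    rw [← h2, ← intervalIntegral.integral_of_le h]
    exact intervalIntegral.abs_integral_le_integral_abs h
  calc ∫ u, |phi lam (t - u) - phi lam (s - u)|
      ≤ ∫ u, ∫ x in Set.Ioc s t, |deriv (phi lam) (x - u)| :=
        integral_mono ((integrable_phi_sub hlam t).sub (integrable_phi_sub hlam s)).abs
          hint.integral_prod_left h1
    _ = ∫ x in Set.Ioc s t, ∫ u, |deriv (phi lam) (x - u)| := integral_integral_swap hint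
    _ = Kphi lam * |t - s| := by
        have : ∀ x : ℝ, ∫ u, |deriv (phi lam) (x - u)| = Kphi lam := fun x =>
          integral_sub_left_eq_self (fun u => |deriv (phi lam) u|) volume x
        simp only [this]
        rw [setIntegral_const, smul_eq_mul, abs_of_nonneg (sub_nonneg.mpr h), mul_comm]
        simp [h]

lemma abs_conv_sub_conv_le (hlam : 1 < lam) {m : ℝ → ℝ} {M : ℝ} (hM : ∀ t, |m t| ≤ M)
    (hi : ∀ t, Integrable fun u => m u * phi lam (t - u)) (s t : ℝ) :
    |conv m (phi lam) t - conv m (phi lam) s| ≤ M * Kphi lam * |t - s| := by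
  have hM0 : 0 ≤ M := (abs_nonneg _).trans (hM 0)
  rw [conv_apply, conv_apply, ← integral_sub (hi t) (hi s), mul_assoc]
  refine le_trans ?_ (mul_le_mul_of_nonneg_left (integral_abs_phi_sub_sub_le hlam s t) hM0)
  rw [← integral_const_mul]
  refine norm_integral_le_of_norm_le
    (f := fun u => m u * phi lam (t - u) - m u * phi lam (s - u))
    (((integrable_phi_sub hlam t).sub (integrable_phi_sub hlam s)).abs.const_mul M)
    (Eventually.of_forall fun u => ?_)
  rw [← mul_sub, Real.norm_eq_abs, abs_mul]
  exact mul_le_mul_of_nonneg_right (hM u) (abs_nonneg _)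

/-! ### The signal class -/

/-- A signal of the class is Lipschitz with constant `K_φ`. If no product with a translate
of the kernel is integrable, the signal vanishes. -/
lemma abs_sub_le_of_mem_BLint (hlam : 1 < lam) {g : ℝ → ℝ} (hg : g ∈ BLint lam) (s t : ℝ) :
    |g t - g s| ≤ Kphi lam * |t - s| := by
  by_cases h : ∃ t₀, Integrable fun u => g u * phi lam (t₀ - u)
  · obtain ⟨t₀, h⟩ := h
    have hne : ∀ᵐ u, phi lam (t₀ - u) ≠ 0 :=
      (Measure.measurePreserving_sub_left volume t₀).quasiMeasurePreserving.ae (ae_phi_ne_zero hlam)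
    have hgm : AEStronglyMeasurable g := by
      have h1 := h.aestronglyMeasurable.aemeasurable.div
        ((continuous_phi hlam).measurable.comp (measurable_id.const_sub t₀)).aemeasurable
      refine (h1.congr ?_).aestronglyMeasurable
      filter_upwards [hne] with u hu
      simp [hu]
    have h2 := abs_conv_sub_conv_le hlam (fun t => (hg t).1)
      (fun t => (integrable_phi_sub hlam t).bdd_mul hgm (Eventually.of_forall fun t => (hg t).1)) s t
    rwa [(hg t).2, (hg s).2, one_mul] at h2
  · push Not at h
    have h0 : ∀ t, g t = 0 := fun t => by
      rw [← (hg t).2, conv_apply, integral_undef (h t)]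
    rw [h0, h0, sub_zero, abs_zero]
    exact mul_nonneg (Kphi_nonneg lam) (abs_nonneg _)

lemma continuous_of_mem_BLint (hlam : 1 < lam) {g : ℝ → ℝ} (hg : g ∈ BLint lam) :
    Continuous g :=
  (LipschitzWith.of_dist_le_mul (K := (Kphi lam).toNNReal) fun x y => by
    simpa [Real.dist_eq, Real.coe_toNNReal _ (Kphi_nonneg lam)] using
      abs_sub_le_of_mem_BLint hlam hg y x).continuous

lemma abs_le_Cphi_of_mem_BLint (hlam : 1 < lam) {g : ℝ → ℝ} (hg : g ∈ BLint lam) (t : ℝ) :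
    |g t| ≤ Cphi lam := by
  rw [← (hg t).2]
  simpa using abs_conv_le hlam (fun t => (hg t).1) t

end OneBit

namespace OneBit

variable {lam : ℝ} {v : ℝ≥0} {μ : ℝ}

/-! ### The iteration driven by a measurable signal -/

/-- The map inside the clipping in the definition of `T`. -/
noncomputable def pre (lam : ℝ) (v : ℝ≥0) (μ : ℝ) (h m : ℝ → ℝ) (t : ℝ) : ℝ :=
  μ * h t + conv (fun u => m u - μ * (F v (m u) - 1 / 2)) (phi lam) t

lemma T_eq (lam : ℝ) (v : ℝ≥0) (μ : ℝ) (h m : ℝ → ℝ) :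
    T lam v μ h m = conv (fun t => clip (pre lam v μ h m t)) (phi lam) := rfl

lemma measurable_F (v : ℝ≥0) : Measurable (F v) := (F_mono v).measurable

section Measurability

variable {α : Type*} [MeasurableSpace α] {h m : α → ℝ → ℝ}

lemma measurable_pre_uncurry (hlam : 1 < lam) (v : ℝ≥0) (μ : ℝ)
    (hh : Measurable (Function.uncurry h)) (hm : Measurable (Function.uncurry m)) :
    Measurable (Function.uncurry fun a t => pre lam v μ (h a) (m a) t) := by
  have h1 : Measurable (Function.uncurry fun a u => m a u - μ * (F v (m a u) - 1 / 2)) :=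
    hm.sub ((((measurable_F v).comp hm).sub_const _).const_mul μ)
  exact (hh.const_mul μ).add (measurable_conv_uncurry hlam h1)

lemma measurable_T_uncurry (hlam : 1 < lam) (v : ℝ≥0) (μ : ℝ)
    (hh : Measurable (Function.uncurry h)) (hm : Measurable (Function.uncurry m)) :
    Measurable (Function.uncurry fun a t => T lam v μ (h a) (m a) t) :=
  measurable_conv_uncurry hlam (measurable_clip.comp (measurable_pre_uncurry hlam v μ hh hm))

lemma measurable_iter_uncurry (hlam : 1 < lam) (v : ℝ≥0) (μ : ℝ)
    (hh : Measurable (Function.uncurry h)) (k : ℕ) :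
    Measurable (Function.uncurry fun a t => iter lam v μ (h a) k t) := by
  induction k with
  | zero => exact measurable_const
  | succ k ih => exact measurable_T_uncurry hlam v μ hh ih

end Measurability

variable {h h' m m' : ℝ → ℝ}

lemma measurable_pre (hlam : 1 < lam) (v : ℝ≥0) (μ : ℝ) (hh : Measurable h) (hm : Measurable m) :
    Measurable (pre lam v μ h m) :=
  (measurable_pre_uncurry (α := Unit) (h := fun _ => h) (m := fun _ => m) hlam v μ
    (hh.comp measurable_snd) (hm.comp measurable_snd)).of_uncurry_left (x := ())

lemma measurable_iter (hlam : 1 < lam) (v : ℝ≥0) (μ : ℝ) (hh : Measurable h) (k : ℕ) :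
    Measurable (iter lam v μ h k) :=
  (measurable_iter_uncurry (α := Unit) (h := fun _ => h) hlam v μ
    (hh.comp measurable_snd) k).of_uncurry_left (x := ())

lemma abs_T_le (hlam : 1 < lam) (v : ℝ≥0) (μ : ℝ) (h m : ℝ → ℝ) (t : ℝ) :
    |T lam v μ h m t| ≤ Cphi lam := by
  rw [T_eq]
  simpa using abs_conv_le hlam (fun t => abs_clip_le _) t

lemma abs_iter_le (hlam : 1 < lam) (v : ℝ≥0) (μ : ℝ) (h : ℝ → ℝ) (k : ℕ) (t : ℝ) :
    |iter lam v μ h k t| ≤ Cphi lam := by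
  cases k with
  | zero => simpa [iter] using Cphi_nonneg lam
  | succ k => exact abs_T_le hlam v μ h _ t

lemma integral_mul_abs_phi_le (hlam : 1 < lam) (hm : Measurable m) {ε : ℝ}
    (hε : ∀ t, |m t| ≤ ε) (t : ℝ) : ∫ u, |m u| * |phi lam (t - u)| ≤ ε * Cphi lam := by
  rw [← integral_abs_phi_sub lam t, ← integral_const_mul]
  refine integral_mono (integrable_mul_abs_phi hlam hm.abs (fun t => by simpa using hε t) t)
    ((integrable_phi_sub hlam t).abs.const_mul ε)
    fun u => mul_le_mul_of_nonneg_right (hε u) (abs_nonneg _)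

lemma abs_T_sub_le (hlam : 1 < lam) (v : ℝ≥0) (μ : ℝ) (hh : Measurable h) (hh' : Measurable h')
    (hm : Measurable m) (hm' : Measurable m') (t : ℝ) :
    |T lam v μ h m t - T lam v μ h' m' t| ≤
      ∫ u, |clip (pre lam v μ h m u) - clip (pre lam v μ h' m' u)| * |phi lam (t - u)| := by
  rw [T_eq, T_eq, conv_sub hlam (m := fun t => clip (pre lam v μ h m t))
    (m' := fun t => clip (pre lam v μ h' m' t)) (measurable_clip.comp (measurable_pre hlam v μ hh hm))
    (measurable_clip.comp (measurable_pre hlam v μ hh' hm')) (fun t => abs_clip_le _)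
    (fun t => abs_clip_le _)]
  exact abs_conv_le_integral _ t

/-- Here h and h' may differ: h = h' serves the contraction, while `H` against `Hbar` serves the
mean-square bound. The filtered difference stays an integral so that expectations can be taken
later. -/
lemma abs_pre_sub_le (hlam : 1 < lam) (hv : v ≠ 0) (hμ : 0 < μ) (hμ' : μ * f v 0 ≤ 1)
    (hm : Measurable m) (hm' : Measurable m') (hmb : ∀ t, |m t| ≤ Cphi lam)
    (hmb' : ∀ t, |m' t| ≤ Cphi lam) (t : ℝ) :
    |pre lam v μ h m t - pre lam v μ h' m' t| ≤
      μ * |h t - h' t| +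
        (1 - μ * f v (Cphi lam)) * ∫ u, |m u - m' u| * |phi lam (t - u)| := by
  have hr : ∀ {m : ℝ → ℝ}, Measurable m → Measurable fun u => m u - μ * (F v (m u) - 1 / 2) :=
    fun hm => hm.sub ((((measurable_F v).comp hm).sub_const _).const_mul μ)
  have hb : ∀ {m : ℝ → ℝ}, (∀ t, |m t| ≤ Cphi lam) →
      ∀ t, |m t - μ * (F v (m t) - 1 / 2)| ≤ Cphi lam + μ * (1 / 2) := fun hm t => by
    refine (abs_sub _ _).trans (add_le_add (hm t) ?_)
    rw [abs_mul, abs_of_pos hμ]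
    exact mul_le_mul_of_nonneg_left (abs_F_sub_half_le _ _) hμ.le
  have h1 : pre lam v μ h m t - pre lam v μ h' m' t = μ * (h t - h' t) +
      conv (fun u => (m u - μ * (F v (m u) - 1 / 2)) - (m' u - μ * (F v (m' u) - 1 / 2)))
        (phi lam) t := by
    rw [← conv_sub hlam (hr hm) (hr hm') (hb hmb) (hb hmb'), pre, pre]
    ring
  rw [h1]
  refine (abs_add_le _ _).trans (add_le_add (by rw [abs_mul, abs_of_pos hμ]) ?_)
  refine (abs_conv_le_integral _ t).trans ?_
  rw [← integral_const_mul]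
  have hd : ∀ u, |m u - m' u| ≤ Cphi lam + Cphi lam :=
    fun u => (abs_sub _ _).trans (add_le_add (hmb u) (hmb' u))
  refine integral_mono (integrable_mul_abs_phi hlam ((hr hm).sub (hr hm')).abs
    (M := (Cphi lam + μ * (1 / 2)) + (Cphi lam + μ * (1 / 2))) (fun u => ?_) t)
    ((integrable_mul_abs_phi hlam (hm.sub hm').abs (fun u => by simpa using hd u) t).const_mul _)
    fun u => ?_
  · rw [abs_abs]
    exact (abs_sub _ _).trans (add_le_add (hb hmb u) (hb hmb' u))
  · simp only [← mul_assoc]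
    exact mul_le_mul_of_nonneg_right (abs_sub_sub_mul_F_le hv hμ hμ' (hmb u) (hmb' u))
      (abs_nonneg _)

/-! ### Convergence of the iterates in the supremum norm. -/

/-- The contraction factor of `T` for the supremum norm. -/
noncomputable def contr (lam : ℝ) (v : ℝ≥0) (μ : ℝ) : ℝ :=
  (1 - μ * f v (Cphi lam)) * Cphi lam * Cphi lam

lemma contr_nonneg (hv : v ≠ 0) (hμ : 0 < μ) (hvar : VarianceCondition lam v μ) :
    0 ≤ contr lam v μ :=
  mul_nonneg (mul_nonneg (hvar.one_sub_nonneg hv hμ) (Cphi_nonneg _)) (Cphi_nonneg _)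

lemma abs_T_sub_le_contr (hlam : 1 < lam) (hv : v ≠ 0) (hμ : 0 < μ)
    (hvar : VarianceCondition lam v μ) (hh : Measurable h)
    (hm : Measurable m) (hm' : Measurable m') (hmb : ∀ t, |m t| ≤ Cphi lam)
    (hmb' : ∀ t, |m' t| ≤ Cphi lam) {ε : ℝ} (hε : ∀ t, |m t - m' t| ≤ ε) (t : ℝ) :
    |T lam v μ h m t - T lam v μ h m' t| ≤ contr lam v μ * ε := by
  refine (abs_T_sub_le hlam v μ hh hh hm hm' t).trans ?_
  refine (integral_mul_abs_phi_le hlam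
    (m := fun u => clip (pre lam v μ h m u) - clip (pre lam v μ h m' u))
    ((measurable_clip.comp (measurable_pre hlam v μ hh hm)).sub
      (measurable_clip.comp (measurable_pre hlam v μ hh hm')))
    (ε := (1 - μ * f v (Cphi lam)) * (ε * Cphi lam)) (fun u => ?_) t).trans (le_of_eq ?_)
  · refine (abs_clip_sub_le _ _).trans ((abs_pre_sub_le hlam hv hμ
      (hvar.mul_f_zero_lt_one hv).le hm hm' hmb hmb' u).trans ?_)
    rw [sub_self, abs_zero, mul_zero, zero_add]
    exact mul_le_mul_of_nonneg_left (integral_mul_abs_phi_le hlam (hm.sub hm') hε u)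
      (hvar.one_sub_nonneg hv hμ)
  · rw [contr]; ring

lemma abs_iter_succ_sub_le (hlam : 1 < lam) (hv : v ≠ 0) (hμ : 0 < μ)
    (hvar : VarianceCondition lam v μ) (hh : Measurable h) (k : ℕ) (t : ℝ) :
    |iter lam v μ h k t - iter lam v μ h (k + 1) t| ≤ Cphi lam * contr lam v μ ^ k := by
  induction k generalizing t with
  | zero =>
    have := abs_iter_le hlam v μ h 1 t
    simpa [iter] using this
  | succ k ih =>
    have := abs_T_sub_le_contr hlam hv hμ hvar hh (measurable_iter hlam v μ hh k)
      (measurable_iter hlam v μ hh (k + 1)) (abs_iter_le hlam v μ h k)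
      (abs_iter_le hlam v μ h (k + 1)) ih t
    refine this.trans (le_of_eq ?_)
    ring

/-- The pointwise limit of the iterates driven by `h`. -/
noncomputable def iterLim (lam : ℝ) (v : ℝ≥0) (μ : ℝ) (h : ℝ → ℝ) (t : ℝ) : ℝ :=
  limUnder atTop fun k : ℕ => iter lam v μ h k t

lemma tendsto_iter (hlam : 1 < lam) (hv : v ≠ 0) (hμ : 0 < μ)
    (hvar : VarianceCondition lam v μ) (hh : Measurable h) (t : ℝ) :
    Tendsto (fun k : ℕ => iter lam v μ h k t) atTop (𝓝 (iterLim lam v μ h t)) :=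
  (cauchySeq_of_le_geometric (contr lam v μ) (Cphi lam) (hvar.contraction_lt_one hv hμ)
    fun k => abs_iter_succ_sub_le hlam hv hμ hvar hh k t).tendsto_limUnder

lemma abs_iter_sub_iterLim_le (hlam : 1 < lam) (hv : v ≠ 0) (hμ : 0 < μ)
    (hvar : VarianceCondition lam v μ) (hh : Measurable h) (k : ℕ) (t : ℝ) :
    |iter lam v μ h k t - iterLim lam v μ h t| ≤
      Cphi lam * contr lam v μ ^ k / (1 - contr lam v μ) :=
  dist_le_of_le_geometric_of_tendsto (contr lam v μ) (Cphi lam) (hvar.contraction_lt_one hv hμ)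
    (fun k => abs_iter_succ_sub_le hlam hv hμ hvar hh k t)
    (tendsto_iter hlam hv hμ hvar hh t) k

lemma tendsto_geometric_bound (hv : v ≠ 0) (hμ : 0 < μ) (hvar : VarianceCondition lam v μ) :
    Tendsto (fun k : ℕ => Cphi lam * contr lam v μ ^ k / (1 - contr lam v μ)) atTop (𝓝 0) := by
  have := (((tendsto_pow_atTop_nhds_zero_of_lt_one (contr_nonneg hv hμ hvar)
    (hvar.contraction_lt_one hv hμ)).const_mul (Cphi lam)).div_const (1 - contr lam v μ))
  simpa using this

lemma tendstoUniformly_iter (hlam : 1 < lam) (hv : v ≠ 0) (hμ : 0 < μ)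
    (hvar : VarianceCondition lam v μ) (hh : Measurable h) :
    TendstoUniformly (fun k : ℕ => iter lam v μ h k) (iterLim lam v μ h) atTop := by
  rw [Metric.tendstoUniformly_iff]
  intro ε hε
  filter_upwards [(tendsto_geometric_bound hv hμ hvar).eventually_lt_const hε] with k hk t
  rw [dist_comm]
  exact (abs_iter_sub_iterLim_le hlam hv hμ hvar hh k t).trans_lt hk

lemma measurable_iterLim_uncurry (hlam : 1 < lam) (hv : v ≠ 0) (hμ : 0 < μ)
    (hvar : VarianceCondition lam v μ) {α : Type*} [MeasurableSpace α] {h : α → ℝ → ℝ}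
    (hh : Measurable (Function.uncurry h)) :
    Measurable (Function.uncurry fun a t => iterLim lam v μ (h a) t) := by
  refine measurable_of_tendsto_metrizable (fun k => measurable_iter_uncurry hlam v μ hh k) ?_
  rw [tendsto_pi_nhds]
  exact fun p => tendsto_iter hlam hv hμ hvar hh.of_uncurry_left p.2

lemma abs_iterLim_le (hlam : 1 < lam) (hv : v ≠ 0) (hμ : 0 < μ)
    (hvar : VarianceCondition lam v μ) (hh : Measurable h) (t : ℝ) :
    |iterLim lam v μ h t| ≤ Cphi lam :=
  le_of_tendsto (tendsto_iter hlam hv hμ hvar hh t).abs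
    (Eventually.of_forall fun k => abs_iter_le hlam v μ h k t)

lemma measurable_iterLim (hlam : 1 < lam) (hv : v ≠ 0) (hμ : 0 < μ)
    (hvar : VarianceCondition lam v μ) (hh : Measurable h) : Measurable (iterLim lam v μ h) :=
  measurable_of_tendsto_metrizable (fun k => measurable_iter hlam v μ hh k)
    (tendsto_pi_nhds.mpr (tendsto_iter hlam hv hμ hvar hh))

/-- By the contraction estimate, the images of the iterates converge to the image of the limit; but
these images are the shifted iterates. -/
lemma T_iterLim (hlam : 1 < lam) (hv : v ≠ 0) (hμ : 0 < μ)
    (hvar : VarianceCondition lam v μ) (hh : Measurable h) (t : ℝ) :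
    T lam v μ h (iterLim lam v μ h) t = iterLim lam v μ h t := by
  have h1 : Tendsto (fun k : ℕ => iter lam v μ h (k + 1) t) atTop
      (𝓝 (T lam v μ h (iterLim lam v μ h) t)) := by
    rw [tendsto_iff_dist_tendsto_zero]
    have h2 := (tendsto_geometric_bound hv hμ hvar).const_mul (contr lam v μ)
    rw [mul_zero] at h2
    refine squeeze_zero (fun _ => dist_nonneg) (fun k => ?_) h2
    exact abs_T_sub_le_contr hlam hv hμ hvar hh (measurable_iter hlam v μ hh k)
      (measurable_iterLim hlam hv hμ hvar hh) (abs_iter_le hlam v μ h k)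
      (abs_iterLim_le hlam hv hμ hvar hh) (abs_iter_sub_iterLim_le hlam hv hμ hvar hh k) t
  exact tendsto_nhds_unique h1
    ((tendsto_iter hlam hv hμ hvar hh t).comp (tendsto_add_atTop_nat 1))

/-- A signal of the class is a fixed point of the map driven by its own filtered statistics. -/
lemma T_eq_self_of_mem_BLint (hlam : 1 < lam) (v : ℝ≥0) (μ : ℝ) {g : ℝ → ℝ}
    (hg : g ∈ BLint lam) (t : ℝ) :
    T lam v μ (conv (fun u => F v (g u) - 1 / 2) (phi lam)) g t = g t := by
  have hgm : Measurable g := (continuous_of_mem_BLint hlam hg).measurable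
  have hr : Measurable fun u => μ * (F v (g u) - 1 / 2) :=
    (((measurable_F v).comp hgm).sub_const _).const_mul μ
  have hrb : ∀ u, |μ * (F v (g u) - 1 / 2)| ≤ |μ| * (1 / 2) := fun u => by
    rw [abs_mul]
    exact mul_le_mul_of_nonneg_left (abs_F_sub_half_le _ _) (abs_nonneg _)
  -- By linearity the two terms with F cancel and g ⋆ φ = g remains. Since |g| ≤ 1, clipping changes
  -- nothing, and the outer filter reproduces g again.
  have hpre : ∀ t, pre lam v μ (conv (fun u => F v (g u) - 1 / 2) (phi lam)) g t = g t := by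
    intro t
    have h1 := conv_sub hlam hgm hr (M := 1 + |μ| * (1 / 2))
      (fun u => (hg u).1.trans (le_add_of_nonneg_right (by positivity)))
      (fun u => (hrb u).trans (le_add_of_nonneg_left zero_le_one)) t
    have h2 : conv (fun u => μ * (F v (g u) - 1 / 2)) (phi lam) t =
        μ * conv (fun u => F v (g u) - 1 / 2) (phi lam) t := by
      simp only [conv_apply, mul_assoc, integral_const_mul]
    rw [pre, ← h1, h2, (hg t).2]
    ring
  rw [T_eq]
  simp only [hpre, fun t => clip_of_abs_le (hg t).1]
  exact (hg t).2

/-! ### Mean squares of filtered random signals -/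

/-- Weighted Cauchy–Schwarz: the quadratic polynomial c ↦ ∫ (q - c)² w is nonnegative, so its
discriminant is not positive. -/
lemma sq_integral_mul_le {q w : ℝ → ℝ} (hw : ∀ u, 0 ≤ w u) (hiw : Integrable w)
    (hqw : Integrable fun u => q u * w u) (hqqw : Integrable fun u => q u ^ 2 * w u) :
    (∫ u, q u * w u) ^ 2 ≤ (∫ u, w u) * ∫ u, q u ^ 2 * w u := by
  have h : ∀ c : ℝ, 0 ≤ (∫ u, w u) * (c * c) + (-2 * ∫ u, q u * w u) * c +
      ∫ u, q u ^ 2 * w u := by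
    intro c
    have h1 : 0 ≤ ∫ u, (c * c * w u + -2 * c * (q u * w u) + q u ^ 2 * w u) := by
      refine integral_nonneg fun u => ?_
      have : c * c * w u + -2 * c * (q u * w u) + q u ^ 2 * w u = (q u - c) ^ 2 * w u := by ring
      simp only [Pi.zero_apply, this]
      exact mul_nonneg (sq_nonneg _) (hw u)
    rw [integral_add (f := fun u => c * c * w u + -2 * c * (q u * w u))
      ((hiw.const_mul _).add (hqw.const_mul _)) hqqw,
      integral_add (f := fun u => c * c * w u) (hiw.const_mul _) (hqw.const_mul _),
      integral_const_mul,
      integral_const_mul] at h1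
    linarith
  have := discrim_le_zero h
  rw [discrim] at this
  linarith

section Random

variable {Ω : Type*} [MeasurableSpace Ω] {P : Measure Ω} [IsProbabilityMeasure P]

/-- Filtering by `|φ|` increases the maximal mean square by a factor of at most `C_φ²`. -/
lemma integral_sq_conv_abs_le (hlam : 1 < lam) {q : Ω → ℝ → ℝ}
    (hq : Measurable (Function.uncurry q)) {M : ℝ} (hM : ∀ ω u, |q ω u| ≤ M) {D : ℝ}
    (hD : ∀ u, ∫ ω, q ω u ^ 2 ∂P ≤ D) (t : ℝ) :
    ∫ ω, (∫ u, |q ω u| * |phi lam (t - u)|) ^ 2 ∂P ≤ Cphi lam ^ 2 * D := by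
  have hqm : ∀ ω, Measurable (q ω) := fun ω => hq.of_uncurry_left
  have hsq : ∀ ω u, |q ω u ^ 2| ≤ M ^ 2 := fun ω u => by
    rw [abs_pow]; exact pow_le_pow_left₀ (abs_nonneg _) (hM ω u) 2
  have hint : Integrable (Function.uncurry fun ω u => q ω u ^ 2 * |phi lam (t - u)|)
      (P.prod volume) := by
    have h1 : Integrable (fun p : Ω × ℝ => |phi lam (t - p.2)|) (P.prod volume) :=
      (integrable_phi_sub hlam t).abs.comp_snd P
    exact h1.bdd_mul (c := M ^ 2) (hq.pow_const 2).aestronglyMeasurable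
      (Eventually.of_forall fun p => hsq p.1 p.2)
  -- Cauchy–Schwarz yields one factor C_φ, the total mass of the weight. Exchanging expectation and
  -- integral yields the other.
  have h1 : ∀ ω, (∫ u, |q ω u| * |phi lam (t - u)|) ^ 2 ≤
      Cphi lam * ∫ u, q ω u ^ 2 * |phi lam (t - u)| := by
    intro ω
    have h2 := integrable_mul_abs_phi hlam ((hqm ω).pow_const 2) (hsq ω) t
    have h3 := sq_integral_mul_le (q := fun u => |q ω u|) (w := fun u => |phi lam (t - u)|)
      (fun _ => abs_nonneg _) (integrable_phi_sub hlam t).abs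
      (integrable_mul_abs_phi hlam (hqm ω).abs (fun u => by simpa using hM ω u) t)
      (by simpa only [sq_abs] using h2)
    simpa only [sq_abs, integral_abs_phi_sub] using h3
  calc ∫ ω, (∫ u, |q ω u| * |phi lam (t - u)|) ^ 2 ∂P
      ≤ ∫ ω, Cphi lam * (∫ u, q ω u ^ 2 * |phi lam (t - u)|) ∂P :=
        integral_mono_of_nonneg (Eventually.of_forall fun _ => sq_nonneg _)
          (hint.integral_prod_left.const_mul _) (Eventually.of_forall h1)
    _ = Cphi lam * ∫ u, (∫ ω, q ω u ^ 2 ∂P) * |phi lam (t - u)| := by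
        rw [integral_const_mul, integral_integral_swap hint]
        simp only [integral_mul_const]
    _ ≤ Cphi lam * ∫ u, D * |phi lam (t - u)| := by
        refine mul_le_mul_of_nonneg_left ?_ (Cphi_nonneg lam)
        refine integral_mono_of_nonneg (Eventually.of_forall fun u => mul_nonneg
          (integral_nonneg fun _ => sq_nonneg _) (abs_nonneg _))
          ((integrable_phi_sub hlam t).abs.const_mul D)
          (Eventually.of_forall fun u => mul_le_mul_of_nonneg_right (hD u) (abs_nonneg _))
    _ = Cphi lam ^ 2 * D := by
        rw [integral_const_mul, integral_abs_phi_sub]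
        ring

end Random

end OneBit

namespace OneBit

/-! ### Sums of uncorrelated random variables -/

section Uncorrelated

variable {Ω : Type*} {Y : ℤ → Ω → ℝ} {c : ℤ → ℝ} {B : ℝ}

lemma summable_mul_of_bounded (hB : ∀ n ω, |Y n ω| ≤ B) (hc : Summable fun n => |c n|) (ω : Ω) :
    Summable fun n => Y n ω * c n := by
  refine (hc.mul_left B).of_norm_bounded fun n => ?_
  rw [Real.norm_eq_abs, abs_mul]
  exact mul_le_mul_of_nonneg_right (hB n ω) (abs_nonneg _)

lemma abs_sum_mul_le (hB : ∀ n ω, |Y n ω| ≤ B) (hc : Summable fun n => |c n|) (hB0 : 0 ≤ B)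
    (s : Finset ℤ) (ω : Ω) : |∑ n ∈ s, Y n ω * c n| ≤ B * ∑' n, |c n| := by
  calc |∑ n ∈ s, Y n ω * c n| ≤ ∑ n ∈ s, B * |c n| := by
        refine (Finset.abs_sum_le_sum_abs _ _).trans (Finset.sum_le_sum fun n _ => ?_)
        rw [abs_mul]
        exact mul_le_mul_of_nonneg_right (hB n ω) (abs_nonneg _)
    _ = B * ∑ n ∈ s, |c n| := (Finset.mul_sum ..).symm
    _ ≤ B * ∑' n, |c n| := mul_le_mul_of_nonneg_left
        (hc.sum_le_tsum s fun _ _ => abs_nonneg _) hB0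

lemma abs_tsum_mul_le (hB : ∀ n ω, |Y n ω| ≤ B) (hc : Summable fun n => |c n|) (hB0 : 0 ≤ B)
    (ω : Ω) : |∑' n, Y n ω * c n| ≤ B * ∑' n, |c n| :=
  le_of_tendsto ((summable_mul_of_bounded hB hc ω).hasSum.abs)
    (Eventually.of_forall fun s => abs_sum_mul_le hB hc hB0 s ω)

variable [MeasurableSpace Ω] {P : Measure Ω} [IsProbabilityMeasure P]

lemma measurable_tsum_mul (hY : ∀ n, Measurable (Y n)) (hB : ∀ n ω, |Y n ω| ≤ B)
    (hc : Summable fun n => |c n|) : Measurable fun ω => ∑' n, Y n ω * c n :=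
  measurable_of_tendsto_metrizable' atTop
    (f := fun (s : Finset ℤ) ω => ∑ n ∈ s, Y n ω * c n)
    (fun s => Finset.measurable_fun_sum s fun n _ => (hY n).mul_const (c n))
    (tendsto_pi_nhds.mpr fun ω => (summable_mul_of_bounded hB hc ω).hasSum)

lemma integrable_of_abs_le {X : Ω → ℝ} (hX : Measurable X) {M : ℝ} (hM : ∀ ω, |X ω| ≤ M) :
    Integrable X P :=
  Integrable.of_bound hX.aestronglyMeasurable M (Eventually.of_forall hM)

lemma integral_tsum_mul_eq_zero (hY : ∀ n, Measurable (Y n)) (hB : ∀ n ω, |Y n ω| ≤ B)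
    (hc : Summable fun n => |c n|) (hB0 : 0 ≤ B) (hmean : ∀ n, ∫ ω, Y n ω ∂P = 0) :
    ∫ ω, ∑' n, Y n ω * c n ∂P = 0 := by
  have h : Tendsto (fun s : Finset ℤ => ∫ ω, ∑ n ∈ s, Y n ω * c n ∂P) atTop
      (𝓝 (∫ ω, ∑' n, Y n ω * c n ∂P)) := by
    refine tendsto_integral_filter_of_dominated_convergence (fun _ => B * ∑' n, |c n|)
      (Eventually.of_forall fun s => (Finset.measurable_fun_sum s fun n _ =>
        (hY n).mul_const (c n)).aestronglyMeasurable)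
      (Eventually.of_forall fun s => Eventually.of_forall (abs_sum_mul_le hB hc hB0 s))
      (integrable_const _)
      (Eventually.of_forall fun ω => (summable_mul_of_bounded hB hc ω).hasSum)
  refine tendsto_nhds_unique h (tendsto_const_nhds.congr fun s => ?_)
  rw [integral_finsetSum s fun n _ => (integrable_of_abs_le (hY n) (hB n)).mul_const (c n)]
  simp [integral_mul_const, hmean]

/-- For finite sums the cross terms vanish and only the diagonal is left. Dominated convergence
passes to the series, since all partial sums share one bound. -/
lemma integral_sq_tsum_mul_le (hY : ∀ n, Measurable (Y n)) (hB : ∀ n ω, |Y n ω| ≤ B)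
    (hc : Summable fun n => |c n|) (hc2 : Summable fun n => |c n| ^ 2) (hB0 : 0 ≤ B) {K : ℝ}
    (hK : ∀ n, ∫ ω, Y n ω ^ 2 ∂P ≤ K)
    (hunc : ∀ n m, n ≠ m → ∫ ω, Y n ω * Y m ω ∂P = 0) :
    ∫ ω, (∑' n, Y n ω * c n) ^ 2 ∂P ≤ K * ∑' n, |c n| ^ 2 := by
  have hK0 : 0 ≤ K := (integral_nonneg fun _ => sq_nonneg _).trans (hK 0)
  have h : Tendsto (fun s : Finset ℤ => ∫ ω, (∑ n ∈ s, Y n ω * c n) ^ 2 ∂P) atTop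
      (𝓝 (∫ ω, (∑' n, Y n ω * c n) ^ 2 ∂P)) := by
    refine tendsto_integral_filter_of_dominated_convergence (fun _ => (B * ∑' n, |c n|) ^ 2)
      (Eventually.of_forall fun s => ((Finset.measurable_fun_sum s fun n _ =>
        (hY n).mul_const (c n)).pow_const 2).aestronglyMeasurable)
      (Eventually.of_forall fun s => Eventually.of_forall fun ω => ?_)
      (integrable_const _)
      (Eventually.of_forall fun ω => (summable_mul_of_bounded hB hc ω).hasSum.pow 2)
    rw [Real.norm_eq_abs, abs_pow]
    exact pow_le_pow_left₀ (abs_nonneg _) (abs_sum_mul_le hB hc hB0 s ω) 2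
  refine le_of_tendsto h (Eventually.of_forall fun s => ?_)
  have hYY : ∀ n m, Integrable (fun ω => Y n ω * Y m ω) P := fun n m =>
    integrable_of_abs_le ((hY n).mul (hY m)) (M := B * B) fun ω => by
      rw [abs_mul]; exact mul_le_mul (hB n ω) (hB m ω) (abs_nonneg _) hB0
  have hexp : ∀ ω, (∑ n ∈ s, Y n ω * c n) ^ 2 =
      ∑ n ∈ s, ∑ m ∈ s, (Y n ω * Y m ω) * (c n * c m) := by
    intro ω
    rw [sq, Finset.sum_mul_sum]
    exact Finset.sum_congr rfl fun n _ => Finset.sum_congr rfl fun m _ => by ring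
  simp only [hexp]
  rw [integral_finsetSum s fun n _ => integrable_finsetSum s fun m _ => (hYY n m).mul_const _]
  refine le_trans (Finset.sum_le_sum fun n hn => ?_)
    ((Finset.mul_sum s (fun n => |c n| ^ 2) K).symm.le.trans
      (mul_le_mul_of_nonneg_left (hc2.sum_le_tsum s fun _ _ => by positivity) hK0))
  rw [integral_finsetSum s fun m _ => (hYY n m).mul_const _]
  simp only [integral_mul_const]
  rw [Finset.sum_eq_single n (fun m _ hm => by rw [hunc n m hm.symm, zero_mul])
    (fun h => absurd hn h), sq_abs, ← sq]
  have := hK n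
  simp only [sq] at this ⊢
  exact mul_le_mul_of_nonneg_right this (mul_self_nonneg _)

end Uncorrelated

/-! ### The one-bit samples -/

section Samples

variable {lam : ℝ} {vW vd : ℝ≥0} {g : ℝ → ℝ}
  {Ω : Type*} {W Wd : ℝ → Ω → ℝ}

lemma bit_sq (s : ℝ) (ω : Ω) : bit g W Wd s ω ^ 2 = bit g W Wd s ω := by
  unfold bit; split_ifs <;> norm_num

lemma bit_nonneg (s : ℝ) (ω : Ω) : 0 ≤ bit g W Wd s ω := by
  unfold bit; split_ifs <;> norm_num

lemma bit_le_one (s : ℝ) (ω : Ω) : bit g W Wd s ω ≤ 1 := by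
  unfold bit; split_ifs <;> norm_num

lemma abs_bit_sub_half_le (s : ℝ) (ω : Ω) : |bit g W Wd s ω - 1 / 2| ≤ 1 / 2 := by
  rw [abs_le]
  constructor <;> linarith [bit_nonneg (g := g) (W := W) (Wd := Wd) s ω,
    bit_le_one (g := g) (W := W) (Wd := Wd) s ω]

lemma tau_pos (hlam : 1 < lam) {N : ℕ} (hN : 1 ≤ N) : 0 < tau lam N := by
  have : (0 : ℝ) < N := by exact_mod_cast hN
  unfold tau; positivity

lemma abs_H_le (hlam : 1 < lam) {N : ℕ} (hN : 1 ≤ N) (t : ℝ) (ω : Ω) :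
    |H lam g W Wd N ω t| ≤
      tau lam N * (1 / 2 * ∑' n : ℤ, |phi lam (t - n * tau lam N)|) := by
  rw [H, abs_mul, abs_of_pos (tau_pos hlam hN)]
  exact mul_le_mul_of_nonneg_left (abs_tsum_mul_le
    (Y := fun (n : ℤ) ω => bit g W Wd (n * tau lam N) ω - 1 / 2)
    (fun n p => abs_bit_sub_half_le _ _)
    (summable_abs_phi_samples hlam (tau_pos hlam hN) t) (by norm_num) ω) (tau_pos hlam hN).le

variable [MeasurableSpace Ω] {P : Measure Ω}

lemma measurable_bit (hWmeas : ∀ t, Measurable (W t)) (hWdmeas : ∀ t, Measurable (Wd t)) (s : ℝ) :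
    Measurable (bit g W Wd s) :=
  Measurable.ite (measurableSet_le measurable_const
    (((hWmeas s).const_add (g s)).add (hWdmeas s))) measurable_const measurable_const

/-- The bit is 1 when the total noise is at least -g(s); by the symmetry of the Gaussian this has
probability F(g(s)). -/
lemma integral_bit (hWmeas : ∀ t, Measurable (W t)) (hWdmeas : ∀ t, Measurable (Wd t))
    (hWlaw : ∀ t, P.map (W t) = gaussianReal 0 vW) (hWdlaw : ∀ t, P.map (Wd t) = gaussianReal 0 vd)
    (hindep : iIndepFun (Sum.elim W Wd) P) (s : ℝ) :
    ∫ ω, bit g W Wd s ω ∂P = F (vW + vd) (g s) := by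
  have hi : IndepFun (W s) (Wd s) P :=
    hindep.indepFun (i := Sum.inl s) (j := Sum.inr s) Sum.inl_ne_inr
  have hlaw : P.map (W s + Wd s) = gaussianReal 0 (vW + vd) := by
    simpa using gaussianReal_add_gaussianReal_of_indepFun hi (hWlaw s) (hWdlaw s)
  have hset : MeasurableSet ((W s + Wd s) ⁻¹' Set.Ici (-g s)) :=
    ((hWmeas s).add (hWdmeas s)) measurableSet_Ici
  have hbit : bit g W Wd s = ((W s + Wd s) ⁻¹' Set.Ici (-g s)).indicator 1 := by
    ext ω
    simp only [bit, Set.indicator, Set.mem_preimage, Set.mem_Ici, Pi.add_apply, Pi.one_apply]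
    congr 1
    rw [eq_iff_iff, neg_le_iff_add_nonneg']
    ring_nf
  rw [hbit, integral_indicator_one hset, ← gaussianReal_real_Ici_neg, ← hlaw,
    map_measureReal_apply ((hWmeas s).add (hWdmeas s)) measurableSet_Ici]

lemma indepFun_bit (hWmeas : ∀ t, Measurable (W t)) (hWdmeas : ∀ t, Measurable (Wd t))
    (hindep : iIndepFun (Sum.elim W Wd) P) {s t : ℝ} (hst : s ≠ t) :
    IndepFun (bit g W Wd s) (bit g W Wd t) P := by
  have hm : ∀ i, Measurable (Sum.elim W Wd i) := by
    rintro (i | i)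
    · exact hWmeas i
    · exact hWdmeas i
  have h := hindep.indepFun_prodMk_prodMk hm (Sum.inl s) (Sum.inr s) (Sum.inl t) (Sum.inr t)
    (by simpa using hst) (by simp) (by simp) (by simpa using hst)
  have hφ : ∀ a : ℝ, Measurable fun p : ℝ × ℝ => if 0 ≤ g a + p.1 + p.2 then (1 : ℝ) else 0 :=
    fun a => Measurable.ite (measurableSet_le measurable_const
      ((measurable_fst.const_add (g a)).add measurable_snd)) measurable_const measurable_const
  exact h.comp (hφ s) (hφ t)

lemma measurable_H_uncurry (hlam : 1 < lam) (hWmeas : ∀ t, Measurable (W t))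
    (hWdmeas : ∀ t, Measurable (Wd t)) {N : ℕ} (hN : 1 ≤ N) :
    Measurable (Function.uncurry (H lam g W Wd N)) := by
  refine Measurable.const_mul ?_ _
  refine measurable_of_tendsto_metrizable' (atTop : Filter (Finset ℤ))
    (f := fun (s : Finset ℤ) (p : Ω × ℝ) =>
      ∑ n ∈ s, (bit g W Wd (n * tau lam N) p.1 - 1 / 2) * phi lam (p.2 - n * tau lam N))
    (fun s => Finset.measurable_fun_sum s fun n _ => ?_) (tendsto_pi_nhds.mpr fun p => ?_)
  · exact (((measurable_bit hWmeas hWdmeas _).comp measurable_fst).sub_const _).mul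
      ((continuous_phi hlam).measurable.comp (measurable_snd.sub_const _))
  · exact (summable_mul_of_bounded
      (Y := fun (n : ℤ) (p : Ω × ℝ) => bit g W Wd (n * tau lam N) p.1 - 1 / 2)
      (fun n p => abs_bit_sub_half_le _ _)
      (summable_abs_phi_samples hlam (tau_pos hlam hN) p.2) p).hasSum

/-- The filtered statistics of the signal. -/
noncomputable def Hbar (lam : ℝ) (v : ℝ≥0) (g : ℝ → ℝ) : ℝ → ℝ :=
  conv (fun u => F v (g u) - 1 / 2) (phi lam)

/-- The bias of the interpolated samples. -/
lemma abs_bias_le (hlam : 1 < lam) {v : ℝ≥0} (hv : v ≠ 0) (hg : g ∈ BLint lam) {N : ℕ}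
    (hN : 1 ≤ N) (t : ℝ) :
    |tau lam N * (∑' n : ℤ, (F v (g (n * tau lam N)) - 1 / 2) * phi lam (t - n * tau lam N)) -
      Hbar lam v g t| ≤ C3 lam v / N := by
  have hN0 : (0 : ℝ) < N := by exact_mod_cast hN
  have h := abs_riemann_sum_sub_integral_le (tau_pos hlam hN) (contDiff_phi_sub hlam t)
    (integrable_phi_sub hlam t) (integrable_deriv_phi_sub hlam t)
    -- F is Δ-Lipschitz and g is K_φ-Lipschitz, and |g| ≤ 1 gives the bound B. Together they produce
    -- τλC_3 = C_3/N.
    (p := fun u => F v (g u) - 1 / 2) (L := f v 0 * Kphi lam) (B := F v 1 - 1 / 2)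
    (fun x y => by
      rw [sub_sub_sub_cancel_right, mul_assoc]
      exact (abs_F_sub_le hv _ _).trans
        (mul_le_mul_of_nonneg_left (abs_sub_le_of_mem_BLint hlam hg y x) (f_pos hv 0).le))
    (mul_nonneg (f_pos hv 0).le (Kphi_nonneg lam))
    (fun x => abs_F_sub_half_le_of_abs_le_one hv (hg x).1)
  rw [integral_abs_phi_sub, integral_abs_deriv_phi_sub] at h
  refine h.trans (le_of_eq ?_)
  unfold C3 tau
  field_simp

variable [IsProbabilityMeasure P]

/-- The mean-squared error of the interpolated samples. -/
lemma integral_sq_H_sub_Hbar_le (hlam : 1 < lam) (hv : vW + vd ≠ 0) (hg : g ∈ BLint lam)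
    (hWmeas : ∀ t, Measurable (W t)) (hWdmeas : ∀ t, Measurable (Wd t))
    (hWlaw : ∀ t, P.map (W t) = gaussianReal 0 vW) (hWdlaw : ∀ t, P.map (Wd t) = gaussianReal 0 vd)
    (hindep : iIndepFun (Sum.elim W Wd) P) {N : ℕ} (hN : 1 ≤ N) (t : ℝ) :
    ∫ ω, (H lam g W Wd N ω t - Hbar lam (vW + vd) g t) ^ 2 ∂P ≤
      C2 lam / N + C3 lam (vW + vd) ^ 2 / N ^ 2 := by
  have hN0 : (0 : ℝ) < N := by exact_mod_cast hN
  have hτ := tau_pos hlam hN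
  set τ := tau lam N with hτdef
  set v := vW + vd with hvdef
  set b := τ * (∑' n : ℤ, (F v (g (n * τ)) - 1 / 2) * phi lam (t - n * τ)) - Hbar lam v g t
    with hb
  have hbias : |b| ≤ C3 lam v / N := abs_bias_le hlam hv hg hN t
  let Y : ℤ → Ω → ℝ := fun n ω => bit g W Wd (n * τ) ω - F v (g (n * τ))
  let c : ℤ → ℝ := fun n => phi lam (t - n * τ)
  have hc : Summable fun n => |c n| := summable_abs_phi_samples hlam hτ t
  have hYm : ∀ n, Measurable (Y n) := fun n => (measurable_bit hWmeas hWdmeas _).sub_const _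
  have hYb : ∀ n ω, |Y n ω| ≤ 1 := fun n ω => by
    have h1 := bit_nonneg (g := g) (W := W) (Wd := Wd) (n * τ) ω
    have h2 := bit_le_one (g := g) (W := W) (Wd := Wd) (n * τ) ω
    have h3 := F_nonneg v (g (n * τ))
    have h4 := F_le_one v (g (n * τ))
    rw [abs_le]; constructor <;> simp only [Y] <;> linarith
  have hbi : ∀ s, Integrable (bit g W Wd s) P := fun s =>
    integrable_of_abs_le (measurable_bit hWmeas hWdmeas s) (M := 1) fun ω => by
      rw [abs_of_nonneg (bit_nonneg s ω)]; exact bit_le_one s ω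
  have hmean : ∀ n, ∫ ω, Y n ω ∂P = 0 := fun n => by
    simp only [Y]
    rw [integral_sub (hbi _) (integrable_const _),
      integral_bit hWmeas hWdmeas hWlaw hWdlaw hindep]
    simp [hvdef]
  -- A Bernoulli variable of mean p has variance p(1 - p) ≤ 1/4.
  have hvar : ∀ n, ∫ ω, Y n ω ^ 2 ∂P ≤ 1 / 4 := fun n => by
    have h1 : ∀ ω, Y n ω ^ 2 = bit g W Wd (n * τ) ω * (1 - 2 * F v (g (n * τ))) +
        F v (g (n * τ)) ^ 2 := fun ω => by
      have := bit_sq (g := g) (W := W) (Wd := Wd) (n * τ) ω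
      simp only [Y]
      linear_combination this
    simp only [h1]
    rw [integral_add ((hbi _).mul_const _) (integrable_const _), integral_mul_const,
      integral_bit hWmeas hWdmeas hWlaw hWdlaw hindep]
    simp only [integral_const, probReal_univ, one_smul]
    nlinarith [sq_nonneg (F v (g (n * τ)) - 1 / 2)]
  have hunc : ∀ n m, n ≠ m → ∫ ω, Y n ω * Y m ω ∂P = 0 := fun n m hnm => by
    have hne : (n : ℝ) * τ ≠ m * τ := fun h => hnm (by
      exact_mod_cast mul_right_cancel₀ hτ.ne' h)
    have hi : IndepFun (Y n) (Y m) P :=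
      (indepFun_bit hWmeas hWdmeas hindep hne).comp
        (measurable_id.sub_const (F v (g (n * τ)))) (measurable_id.sub_const (F v (g (m * τ))))
    rw [hi.integral_fun_mul_eq_mul_integral (hYm n).aestronglyMeasurable
      (hYm m).aestronglyMeasurable, hmean n, zero_mul]
  have hS0 := integral_tsum_mul_eq_zero hYm hYb hc zero_le_one hmean
  have hS2 := integral_sq_tsum_mul_le hYm hYb hc (summable_sq_phi_samples hlam hτ t)
    zero_le_one hvar hunc
  have hSm := measurable_tsum_mul hYm hYb hc
  have hSb := abs_tsum_mul_le hYb hc zero_le_one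
  have hSi : Integrable (fun ω => ∑' n, Y n ω * c n) P := integrable_of_abs_le hSm hSb
  have hSi2 : Integrable (fun ω => (∑' n, Y n ω * c n) ^ 2) P :=
    integrable_of_abs_le (hSm.pow_const 2) (M := (1 * ∑' n, |c n|) ^ 2) fun ω => by
      rw [abs_pow]; exact pow_le_pow_left₀ (abs_nonneg _) (hSb ω) 2
  -- The error is a centred sum plus the deterministic bias b. The mixed term has expectation zero,
  -- so variance and squared bias add without a factor 2.
  have hH : ∀ ω, (H lam g W Wd N ω t - Hbar lam v g t) ^ 2 =
      (τ ^ 2 * (∑' n, Y n ω * c n) ^ 2 + 2 * τ * b * ∑' n, Y n ω * c n) + b ^ 2 := by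
    intro ω
    have hs1 := summable_mul_of_bounded hYb hc ω
    have hs2 : Summable fun n : ℤ => (F v (g (n * τ)) - 1 / 2) * c n :=
      summable_mul_of_bounded (Ω := Unit) (Y := fun n _ => F v (g (n * τ)) - 1 / 2)
        (fun n _ => abs_F_sub_half_le _ _) hc ()
    have h1 : H lam g W Wd N ω t =
        τ * (∑' n, Y n ω * c n) + τ * ∑' n : ℤ, (F v (g (n * τ)) - 1 / 2) * c n := by
      rw [H, ← mul_add, ← hs1.tsum_add hs2]
      congr 2
      ext n
      simp only [Y, c]
      ring
    rw [h1, hb]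
    ring
  simp only [hH]
  rw [integral_add (f := fun ω => τ ^ 2 * (∑' n, Y n ω * c n) ^ 2 + 2 * τ * b * ∑' n, Y n ω * c n)
      ((hSi2.const_mul _).add (hSi.const_mul _)) (integrable_const _),
    integral_add (f := fun ω => τ ^ 2 * (∑' n, Y n ω * c n) ^ 2)
      (hSi2.const_mul _) (hSi.const_mul _), integral_const_mul, integral_const_mul, hS0]
  simp only [integral_const, probReal_univ, one_smul, mul_zero, add_zero]
  refine add_le_add ?_ ?_
  · have h1 := hS2.trans (mul_le_mul_of_nonneg_left (tsum_sq_phi_samples_le hlam hN t)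
      (by norm_num : (0 : ℝ) ≤ 1 / 4))
    -- τ² · (1/4) · N · C_φ'' = C_2/N: averaging over N grids gains one power of N.
    refine (mul_le_mul_of_nonneg_left h1 (sq_nonneg τ)).trans (le_of_eq ?_)
    rw [hτdef]
    unfold C2 tau
    field_simp
  · rw [← div_pow, ← sq_abs b]
    exact pow_le_pow_left₀ (abs_nonneg _) hbias 2

end Samples

end OneBit

namespace OneBit

/-! ### The distortion of the one-bit estimate -/

section Distortion

variable {lam : ℝ} {v : ℝ≥0} {μ : ℝ} {g : ℝ → ℝ} {Ω : Type*} [MeasurableSpace Ω]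
  {P : Measure Ω} [IsProbabilityMeasure P]

/-- One step of the mean-square recursion: the mean-squared error at a point is controlled by the
mean-squared error `S` of the data and by the maximal mean-squared error `D` of the estimate. -/
lemma integral_sq_iterLim_sub_le (hlam : 1 < lam) (hv : v ≠ 0) (hμ : 0 < μ)
    (hvar : VarianceCondition lam v μ) (hg : g ∈ BLint lam) {h : Ω → ℝ → ℝ}
    (hh : Measurable (Function.uncurry h)) {A : ℝ → ℝ} (hA : ∀ ω t, |h ω t| ≤ A t) {S D : ℝ}
    (hS : ∀ t, ∫ ω, (h ω t - Hbar lam v g t) ^ 2 ∂P ≤ S)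
    (hD : ∀ t, ∫ ω, (iterLim lam v μ (h ω) t - g t) ^ 2 ∂P ≤ D) (t : ℝ) :
    ∫ ω, (iterLim lam v μ (h ω) t - g t) ^ 2 ∂P ≤
      2 * Cphi lam ^ 2 * μ ^ 2 * S + beta lam v μ * D := by
  have hhm : ∀ ω, Measurable (h ω) := fun ω => hh.of_uncurry_left
  have hgm : Measurable g := (continuous_of_mem_BLint hlam hg).measurable
  have hgb := abs_le_Cphi_of_mem_BLint hlam hg
  have hbarm : Measurable (Hbar lam v g) :=
    (measurable_conv_uncurry (α := Unit) (m := fun _ u => F v (g u) - 1 / 2) hlam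
      ((((measurable_F v).comp hgm).sub_const (1 / 2)).comp measurable_snd)).of_uncurry_left
        (x := ())
  set κ := 1 - μ * f v (Cphi lam) with hκ
  have hκ0 : 0 ≤ κ := hvar.one_sub_nonneg hv hμ
  have hG := measurable_iterLim_uncurry hlam hv hμ hvar hh
  have hGm : ∀ ω, Measurable (iterLim lam v μ (h ω)) := fun ω => hG.of_uncurry_left
  have hGb : ∀ ω u, |iterLim lam v μ (h ω) u| ≤ Cphi lam := fun ω =>
    abs_iterLim_le hlam hv hμ hvar (hhm ω)
  -- the error of the estimate and its filtered absolute value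
  let q : Ω → ℝ → ℝ := fun ω u => iterLim lam v μ (h ω) u - g u
  have hq : Measurable (Function.uncurry q) := hG.sub (hgm.comp measurable_snd)
  have hqb : ∀ ω u, |q ω u| ≤ Cphi lam + Cphi lam := fun ω u =>
    (abs_sub _ _).trans (add_le_add (hGb ω u) (hgb u))
  let J : Ω → ℝ → ℝ := fun ω u => ∫ w, |q ω w| * |phi lam (u - w)|
  have hJ2 : ∀ u, ∫ ω, J ω u ^ 2 ∂P ≤ Cphi lam ^ 2 * D := integral_sq_conv_abs_le hlam hq hqb hD
  have hJm : ∀ u, Measurable fun ω => J ω u := fun u => by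
    have h1 : StronglyMeasurable (Function.uncurry fun ω w => |q ω w| * |phi lam (u - w)|) :=
      (hq.abs.mul ((continuous_phi hlam).measurable.comp
        (measurable_snd.const_sub u)).abs).stronglyMeasurable
    exact h1.integral_prod_right.measurable
  have hJb : ∀ u ω, |J ω u| ≤ (Cphi lam + Cphi lam) * Cphi lam := fun u ω => by
    rw [abs_of_nonneg (integral_nonneg fun _ => by positivity)]
    exact integral_mul_abs_phi_le hlam ((hGm ω).sub hgm) (hqb ω) u
  -- the difference of the clipped signals
  let d : Ω → ℝ → ℝ := fun ω u => clip (pre lam v μ (h ω) (iterLim lam v μ (h ω)) u) -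
    clip (pre lam v μ (Hbar lam v g) g u)
  have hd : Measurable (Function.uncurry d) :=
    (measurable_clip.comp (measurable_pre_uncurry hlam v μ hh hG)).sub
      ((measurable_clip.comp (measurable_pre hlam v μ hbarm hgm)).comp measurable_snd)
  have hdb : ∀ ω u, |d ω u| ≤ 1 + 1 := fun ω u =>
    (abs_sub _ _).trans (add_le_add (abs_clip_le _) (abs_clip_le _))
  have hdle : ∀ ω u, |d ω u| ≤ μ * |h ω u - Hbar lam v g u| + κ * J ω u := fun ω u =>
    (abs_clip_sub_le _ _).trans (abs_pre_sub_le hlam hv hμ (hvar.mul_f_zero_lt_one hv).le (hGm ω)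
      hgm (hGb ω) hgb u)
  -- The inequality (x + y)² ≤ 2x² + 2y² is the source of the factor 2 in β and of the √2 in the
  -- variance condition.
  have hd2 : ∀ u, ∫ ω, d ω u ^ 2 ∂P ≤ 2 * μ ^ 2 * S + 2 * κ ^ 2 * (Cphi lam ^ 2 * D) := by
    intro u
    have hi1 : Integrable (fun ω => (h ω u - Hbar lam v g u) ^ 2) P :=
      integrable_of_abs_le ((hh.of_uncurry_right.sub_const _).pow_const 2)
        (M := (A u + |Hbar lam v g u|) ^ 2) fun ω => by
        rw [abs_pow]
        exact pow_le_pow_left₀ (abs_nonneg _)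
          ((abs_sub _ _).trans (add_le_add_left (hA ω u) _)) 2
    have hi2 : Integrable (fun ω => J ω u ^ 2) P :=
      integrable_of_abs_le ((hJm u).pow_const 2)
        (M := ((Cphi lam + Cphi lam) * Cphi lam) ^ 2) fun ω => by
        rw [abs_pow]
        exact pow_le_pow_left₀ (abs_nonneg _) (hJb u ω) 2
    calc ∫ ω, d ω u ^ 2 ∂P
        ≤ ∫ ω, (2 * μ ^ 2 * (h ω u - Hbar lam v g u) ^ 2 + 2 * κ ^ 2 * J ω u ^ 2) ∂P := by
          refine integral_mono_of_nonneg (Eventually.of_forall fun _ => sq_nonneg _)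
            ((hi1.const_mul _).add (hi2.const_mul _)) (Eventually.of_forall fun ω => ?_)
          have h1 := pow_le_pow_left₀ (abs_nonneg _) (hdle ω u) 2
          rw [sq_abs] at h1
          refine h1.trans ?_
          simp only [← sq_abs (h ω u - Hbar lam v g u)]
          nlinarith [sq_nonneg (μ * |h ω u - Hbar lam v g u| - κ * J ω u)]
      _ = 2 * μ ^ 2 * ∫ ω, (h ω u - Hbar lam v g u) ^ 2 ∂P + 2 * κ ^ 2 * ∫ ω, J ω u ^ 2 ∂P := by
          rw [integral_add (hi1.const_mul _) (hi2.const_mul _), integral_const_mul,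
            integral_const_mul]
      _ ≤ 2 * μ ^ 2 * S + 2 * κ ^ 2 * (Cphi lam ^ 2 * D) :=
          add_le_add (mul_le_mul_of_nonneg_left (hS u) (by positivity))
            (mul_le_mul_of_nonneg_left (hJ2 u) (by positivity))
  -- Both signals are fixed points, so their difference is the filtered difference d of the clipped
  -- signals.
  have hL : ∀ ω, (iterLim lam v μ (h ω) t - g t) ^ 2 ≤
      (∫ u, |d ω u| * |phi lam (t - u)|) ^ 2 := fun ω => by
    have h1 := abs_T_sub_le hlam v μ (hhm ω) hbarm (hGm ω) hgm t
    have h2 : T lam v μ (Hbar lam v g) g t = g t := T_eq_self_of_mem_BLint hlam v μ hg t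
    rw [T_iterLim hlam hv hμ hvar (hhm ω), h2] at h1
    rw [← sq_abs]
    exact pow_le_pow_left₀ (abs_nonneg _) h1 2
  have hm : Measurable fun ω => ∫ u, |d ω u| * |phi lam (t - u)| := by
    have h1 : StronglyMeasurable (Function.uncurry fun ω w => |d ω w| * |phi lam (t - w)|) :=
      (hd.abs.mul ((continuous_phi hlam).measurable.comp
        (measurable_snd.const_sub t)).abs).stronglyMeasurable
    exact h1.integral_prod_right.measurable
  have hmi : Integrable (fun ω => (∫ u, |d ω u| * |phi lam (t - u)|) ^ 2) P :=
    integrable_of_abs_le (hm.pow_const 2) (M := ((1 + 1) * Cphi lam) ^ 2) fun ω => by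
      rw [abs_pow, abs_of_nonneg (integral_nonneg fun _ => by positivity)]
      exact pow_le_pow_left₀ (integral_nonneg fun _ => by positivity)
        (integral_mul_abs_phi_le hlam hd.of_uncurry_left (hdb ω) t) 2
  calc ∫ ω, (iterLim lam v μ (h ω) t - g t) ^ 2 ∂P
      ≤ ∫ ω, (∫ u, |d ω u| * |phi lam (t - u)|) ^ 2 ∂P :=
        integral_mono_of_nonneg (Eventually.of_forall fun _ => sq_nonneg _) hmi
          (Eventually.of_forall hL)
    _ ≤ Cphi lam ^ 2 * (2 * μ ^ 2 * S + 2 * κ ^ 2 * (Cphi lam ^ 2 * D)) :=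
        integral_sq_conv_abs_le hlam hd hdb hd2 t
    _ = 2 * Cphi lam ^ 2 * μ ^ 2 * S + beta lam v μ * D := by
        rw [beta, sq_abs, ← hκ]
        ring

/-- The squared error of the estimate is bounded and measurable, hence integrable. -/
lemma integrable_sq_iterLim_sub (hlam : 1 < lam) (hv : v ≠ 0) (hμ : 0 < μ)
    (hvar : VarianceCondition lam v μ) (hg : g ∈ BLint lam) {h : Ω → ℝ → ℝ}
    (hh : Measurable (Function.uncurry h)) (t : ℝ) :
    Integrable (fun ω => (iterLim lam v μ (h ω) t - g t) ^ 2) P ∧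
      ∫ ω, (iterLim lam v μ (h ω) t - g t) ^ 2 ∂P ≤ (Cphi lam + Cphi lam) ^ 2 := by
  have hb : ∀ ω, (iterLim lam v μ (h ω) t - g t) ^ 2 ≤ (Cphi lam + Cphi lam) ^ 2 := fun ω => by
    rw [← sq_abs]
    exact pow_le_pow_left₀ (abs_nonneg _) ((abs_sub _ _).trans (add_le_add
      (abs_iterLim_le hlam hv hμ hvar hh.of_uncurry_left t) (abs_le_Cphi_of_mem_BLint hlam hg t))) 2
  have hi : Integrable (fun ω => (iterLim lam v μ (h ω) t - g t) ^ 2) P :=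
    integrable_of_abs_le (((measurable_iterLim_uncurry hlam hv hμ hvar
      hh).of_uncurry_right.sub_const _).pow_const 2) fun ω => by
        rw [abs_of_nonneg (sq_nonneg _)]; exact hb ω
  exact ⟨hi, by simpa using integral_mono hi (integrable_const ((Cphi lam + Cphi lam) ^ 2)) hb⟩

end Distortion

end OneBit

/-! ### Solving the mean-square recursion for the distortion. -/

theorem mainTheorem2
    (lam : ℝ) (hlam : 1 < lam)
    (vW vd : ℝ≥0) (hv : 0 < vW + vd)
    (μ : ℝ) (hμ : 0 < μ) (hvar : OneBit.VarianceCondition lam (vW + vd) μ)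
    (g : ℝ → ℝ) (hg : g ∈ OneBit.BLint lam)
    {Ω : Type*} [MeasurableSpace Ω] (P : Measure Ω) [IsProbabilityMeasure P]
    (W Wd : ℝ → Ω → ℝ)
    (hWmeas : ∀ t, Measurable (W t)) (hWdmeas : ∀ t, Measurable (Wd t))
    (hWlaw : ∀ t, P.map (W t) = gaussianReal 0 vW)
    (hWdlaw : ∀ t, P.map (Wd t) = gaussianReal 0 vd)
    (hindep : iIndepFun (Sum.elim W Wd) P) :
    (∀ N : ℕ, 1 ≤ N →
      (∀ ω, TendstoUniformly
        (fun k : ℕ => OneBit.iter lam (vW + vd) μ (OneBit.H lam g W Wd N ω) k)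
        (OneBit.Ghat lam (vW + vd) μ g W Wd N ω) atTop) ∧
      (∀ t, Integrable (fun ω => (OneBit.Ghat lam (vW + vd) μ g W Wd N ω t - g t) ^ 2) P) ∧
      BddAbove (Set.range (OneBit.mse P lam (vW + vd) μ g W Wd N)) ∧
      OneBit.beta lam (vW + vd) μ < 1 ∧
      OneBit.distortion P lam (vW + vd) μ g W Wd N ≤
        2 * OneBit.Cphi lam ^ 2 * μ ^ 2 / (1 - OneBit.beta lam (vW + vd) μ) *
          (OneBit.C2 lam / N + OneBit.C3 lam (vW + vd) ^ 2 / N ^ 2)) ∧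
    (fun N : ℕ => OneBit.distortion P lam (vW + vd) μ g W Wd N)
      =O[atTop] (fun N : ℕ => 1 / (N : ℝ)) := by
  have hv0 : vW + vd ≠ 0 := hv.ne'
  have hβ := hvar.beta_lt_one hv0 hμ
  have hbound : ∀ N : ℕ, 1 ≤ N →
      BddAbove (Set.range (OneBit.mse P lam (vW + vd) μ g W Wd N)) ∧
      OneBit.distortion P lam (vW + vd) μ g W Wd N ≤
        2 * OneBit.Cphi lam ^ 2 * μ ^ 2 / (1 - OneBit.beta lam (vW + vd) μ) *
          (OneBit.C2 lam / N + OneBit.C3 lam (vW + vd) ^ 2 / N ^ 2) := by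
    intro N hN
    have hH := OneBit.measurable_H_uncurry (g := g) hlam hWmeas hWdmeas hN
    have hbdd : BddAbove (Set.range (OneBit.mse P lam (vW + vd) μ g W Wd N)) := by
      refine ⟨(OneBit.Cphi lam + OneBit.Cphi lam) ^ 2, ?_⟩
      rintro _ ⟨t, rfl⟩
      exact (OneBit.integrable_sq_iterLim_sub hlam hv0 hμ hvar hg hH t).2
    refine ⟨hbdd, ?_⟩
    -- The recursion is applied with D equal to the distortion itself. The bound `hbdd` is
    -- essential: it makes the supremum dominate each pointwise error, so the β-term can be
    -- absorbed.
    have h1 : OneBit.distortion P lam (vW + vd) μ g W Wd N ≤ 2 * OneBit.Cphi lam ^ 2 * μ ^ 2 *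
        (OneBit.C2 lam / N + OneBit.C3 lam (vW + vd) ^ 2 / N ^ 2) +
        OneBit.beta lam (vW + vd) μ * OneBit.distortion P lam (vW + vd) μ g W Wd N :=
      ciSup_le fun t => OneBit.integral_sq_iterLim_sub_le hlam hv0 hμ hvar hg hH
        (fun ω t => OneBit.abs_H_le hlam hN t ω)
        (OneBit.integral_sq_H_sub_Hbar_le hlam hv0 hg hWmeas hWdmeas hWlaw hWdlaw hindep hN)
        (fun t => le_ciSup hbdd t) t
    rw [div_mul_eq_mul_div, le_div_iff₀ (sub_pos.mpr hβ)]
    linarith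
  refine ⟨fun N hN => ⟨fun ω => ?_, fun t => ?_, (hbound N hN).1, hβ, (hbound N hN).2⟩, ?_⟩
  · exact OneBit.tendstoUniformly_iter hlam hv0 hμ hvar
      (OneBit.measurable_H_uncurry hlam hWmeas hWdmeas hN).of_uncurry_left
  · exact (OneBit.integrable_sq_iterLim_sub hlam hv0 hμ hvar hg
      (OneBit.measurable_H_uncurry hlam hWmeas hWdmeas hN) t).1
  · refine IsBigO.of_bound (2 * OneBit.Cphi lam ^ 2 * μ ^ 2 / (1 - OneBit.beta lam (vW + vd) μ) *
      (OneBit.C2 lam + OneBit.C3 lam (vW + vd) ^ 2)) ?_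
    filter_upwards [eventually_ge_atTop 1] with N hN
    have hN1 : (1 : ℝ) ≤ N := by exact_mod_cast hN
    have hN0 : (0 : ℝ) < N := by linarith
    have h0 : 0 ≤ OneBit.distortion P lam (vW + vd) μ g W Wd N :=
      Real.iSup_nonneg fun t => integral_nonneg fun _ => sq_nonneg _
    rw [Real.norm_of_nonneg h0, Real.norm_of_nonneg (by positivity), mul_assoc]
    refine (hbound N hN).2.trans (mul_le_mul_of_nonneg_left ?_
      (div_nonneg (by positivity) (sub_pos.mpr hβ).le))
    rw [mul_one_div, add_div]
    -- For N ≥ 1 the squared bias C_3²/N² is at most C_3²/N.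
    refine add_le_add le_rfl (div_le_div_of_nonneg_left (sq_nonneg _) hN0 ?_)
    nlinarith
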